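/- Let $D\subset\mathbb C$ be an open set with $D=\overline D$, and let $\Omega_D=\{\alpha+J\beta:\alpha+i\beta\in D,\ J\in\mathbb S\}\subset\mathbb H$ be its circularization, where $\mathbb S=\{J\in\mathbb H: J^2=-1\}$. A function $f:\Omega_D\to\mathbb H$ is slice regular if $f(\alpha+J\beta)=F_0(\alpha+i\beta)+JF_1(\alpha+i\beta)$ for all $\alpha+i\beta\in D$ and $J\in\mathbb S$, for a holomorphic $F=F_0+\sqrt{-1}F_1:D\to\mathbb H\otimes_{\mathbb R}\mathbb C$ with $F(\bar z)=\overline{F(z)}$; write $f=\mathcal I(F)$, and let $\mathcal I(F)\cdot\mathcal I(G)=\mathcal I(FG)$ be the slice product. For a (sufficiently smooth) slice function $f=\mathcal I(F)$ put $(\partial_s f)(x)=(2\,\mathrm{Im}\,x)^{-1}(f(x)-f(\bar x))$ for non-real $x$, and $\partial_c f=\mathcal I(\partial F/\partial z)$. For a non-real $q_0$ let $\mathbb S_{q_0}=\mathrm{Re}(q_0)+\mathbb S\,|\mathrm{Im}(q_0)|$ and $\Delta_{q_0}(x)=x^2-2\,\mathrm{Re}(q_0)x+|q_0|^2$. Multiplicities.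 Suppose that on $\Omega_D$ $$f(x)=\Delta_{q_0}^m(x)\,(x-q_1)\cdot(x-q_2)\cdots(x-q_r)\cdot g(x)$$ with $m,r\in\mathbb N$, $q_1,\dots,q_r\in\mathbb S_{q_0}$, $q_i\ne\bar q_{i+1}$ for $1\le i<r$, and $g$ slice regular on $\Omega_D$ without zeros in $\mathbb S_{q_0}$. Then $2m$ is called the spherical multiplicity of $f$ at $\mathbb S_{q_0}$, and $r$ the isolated multiplicity of $q_1$ (if $r\geq 1$); points of $\mathbb S_{q_0}$ other than $q_1$ have isolated multiplicity $0$. Corollary 4.3 (spherical multiplicity criterion). Let $f$ be slice regular on $\Omega_D$ and $q_0\in\Omega_D\setminus\mathbb R$. Assume that either $D$ is connected and $D\cap\mathbb R\neq\emptyset$, or there are points $x$ arbitrarily close to $q_0$ such that $f$ has no zero on the sphere $\mathbb S_x=\mathrm{Re}(x)+\mathbb S\,|\mathrm{Im}(x)|$. Let $n\in\mathbb N$ be such that $$((\partial_c\partial_s)^kf)(q_0)=(\partial_s(\partial_c\partial_s)^kf)(q_0)=0\quad\text{for all }0\le k<n,$$ and $((\partial_c\partial_s)^nf)(q_0)\ne0$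 or $(\partial_s(\partial_c\partial_s)^nf)(q_0)\neq0$. Then $2n$ is the spherical multiplicity of $f$ at $\mathbb S_{q_0}$: a factorization as above exists, and every such factorization has $m=n$. Moreover, $q_0$ has positive isolated multiplicity (that is, there is such a factorization with $r\ge1$ and $q_1=q_0$) if and only if $((\partial_c\partial_s)^nf)(q_0)=0$. -/

import Mathlib

open scoped Quaternion Topology

noncomputable section

namespace SliceAnalysis

/-- The set `𝕊` of imaginary units of the quaternions. -/
def imagUnits : Set ℍ[ℝ] := {J | J * J = -1}

/-- The point `α + J β` of the slice `ℂ_J` that corresponds to `z = α + i β`. -/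
def slicePoint (J : ℍ[ℝ]) (z : ℂ) : ℍ[ℝ] := (z.re : ℍ[ℝ]) + J * (z.im : ℍ[ℝ])

/-- The circularization `Ω_D = {α + J β | α + i β ∈ D, J ∈ 𝕊}` of `D ⊆ ℂ`. -/
def circularization (D : Set ℂ) : Set ℍ[ℝ] :=
  {x | ∃ z ∈ D, ∃ J ∈ imagUnits, x = slicePoint J z}

/-- The sphere `𝕊_q = Re q + 𝕊 |Im q|`. -/
def sphere (q : ℍ[ℝ]) : Set ℍ[ℝ] :=
  {x | ∃ J ∈ imagUnits, x = slicePoint J ⟨q.re, ‖q.im‖⟩}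

/-! The algebra `ℍ ⊗ ℂ = {x + √-1 y | x, y ∈ ℍ}` is realized as the algebra `ℍ[ℂ]` of quaternions
with complex coefficients, in which `√-1` is the (central) scalar `Complex.I`. -/

/-- The element `x + √-1 y` of `ℍ ⊗ ℂ`. -/
def ofParts (x y : ℍ[ℝ]) : ℍ[ℂ] :=
  ⟨⟨x.re, y.re⟩, ⟨x.imI, y.imI⟩, ⟨x.imJ, y.imJ⟩, ⟨x.imK, y.imK⟩⟩

/-- The component `x` of `x + √-1 y`. -/
def part0 (w : ℍ[ℂ]) : ℍ[ℝ] := ⟨w.re.re, w.imI.re, w.imJ.re, w.imK.re⟩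

/-- The component `y` of `x + √-1 y`. -/
def part1 (w : ℍ[ℂ]) : ℍ[ℝ] := ⟨w.re.im, w.imI.im, w.imJ.im, w.imK.im⟩

/-- `F` is a stem function on `D`: `F (conj z) = F₀ z - √-1 F₁ z` for `z ∈ D`. -/
def IsStem (D : Set ℂ) (F : ℂ → ℍ[ℂ]) : Prop :=
  ∀ z ∈ D, F (star z) = ofParts (part0 (F z)) (-part1 (F z))

/-- Holomorphy of an `ℍ ⊗ ℂ`-valued function with respect to the complex structure `√-1`. -/
def IsHolomorphicOn (F : ℂ → ℍ[ℂ]) (D : Set ℂ) : Prop :=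
  DifferentiableOn ℂ (fun z => (F z).re) D ∧ DifferentiableOn ℂ (fun z => (F z).imI) D ∧
  DifferentiableOn ℂ (fun z => (F z).imJ) D ∧ DifferentiableOn ℂ (fun z => (F z).imK) D

/-- `f` is the slice function on `Ω_D` induced by `F`:
`f (α + J β) = F₀ (α + i β) + J F₁ (α + i β)`. -/
def IsInducedBy (D : Set ℂ) (F : ℂ → ℍ[ℂ]) (f : ℍ[ℝ] → ℍ[ℝ]) : Prop :=
  ∀ z ∈ D, ∀ J ∈ imagUnits, f (slicePoint J z) = part0 (F z) + J * part1 (F z)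

/-- `f` is (left) slice regular on `Ω_D`. Only the values of `f` on `Ω_D` matter. -/
def IsSliceRegular (D : Set ℂ) (f : ℍ[ℝ] → ℍ[ℝ]) : Prop :=
  ∃ F : ℂ → ℍ[ℂ], IsStem D F ∧ IsHolomorphicOn F D ∧ IsInducedBy D F f

/-- The operator `𝓘`: the slice function induced by a stem function, evaluated by writing
`x = α + J β` with `β = |Im x|` and `J = Im x / |Im x|` (a stem function has `F₁ = 0` at real
points, so there the choice of `J` is irrelevant). -/
def induce (F : ℂ → ℍ[ℂ]) (x : ℍ[ℝ]) : ℍ[ℝ] :=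
  part0 (F ⟨x.re, ‖x.im‖⟩) + ((‖x.im‖⁻¹ : ℝ) • x.im) * part1 (F ⟨x.re, ‖x.im‖⟩)

/-- The imaginary unit `i`. -/
def unitI : ℍ[ℝ] := ⟨0, 1, 0, 0⟩

/-- The inverse of `𝓘`: the stem function of a slice function, read off on the slice `ℂ_i` of
the unit `i` (for a slice function the result does not depend on the unit). -/
def stemOf (f : ℍ[ℝ] → ℍ[ℝ]) (z : ℂ) : ℍ[ℂ] :=
  ofParts ((1 / 2 : ℝ) • (f (slicePoint unitI z) + f (slicePoint (-unitI) z)))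
    (-unitI * ((1 / 2 : ℝ) • (f (slicePoint unitI z) - f (slicePoint (-unitI) z))))

/-- `∂/∂z = (∂/∂α - √-1 ∂/∂β) / 2` on complex-valued functions. -/
def wirtinger (φ : ℂ → ℂ) (z : ℂ) : ℂ :=
  (1 / 2 : ℂ) * (fderiv ℝ φ z 1 - Complex.I * fderiv ℝ φ z Complex.I)

/-- `∂F/∂z` for `ℍ ⊗ ℂ`-valued functions. -/
def stemDeriv (F : ℂ → ℍ[ℂ]) (z : ℂ) : ℍ[ℂ] :=
  ⟨wirtinger (fun w => (F w).re) z, wirtinger (fun w => (F w).imI) z,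
    wirtinger (fun w => (F w).imJ) z, wirtinger (fun w => (F w).imK) z⟩

/-- The spherical derivative `(∂_s f)(x) = (2 Im x)⁻¹ (f x - f xᶜ)`, for non-real `x`. -/
def sphericalDeriv (f : ℍ[ℝ] → ℍ[ℝ]) (x : ℍ[ℝ]) : ℍ[ℝ] :=
  (2 * x.im)⁻¹ * (f x - f (star x))

/-- The slice derivative `∂_c f = 𝓘 (∂F/∂z)` of `f = 𝓘 F`. -/
def sliceDeriv (f : ℍ[ℝ] → ℍ[ℝ]) : ℍ[ℝ] → ℍ[ℝ] := induce (stemDeriv (stemOf f))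

/-- The iterated operator `(∂_c ∂_s)^k`. -/
def csDeriv (k : ℕ) (f : ℍ[ℝ] → ℍ[ℝ]) : ℍ[ℝ] → ℍ[ℝ] :=
  (fun h => sliceDeriv (sphericalDeriv h))^[k] f

/-- The slice product `𝓘 F · 𝓘 G = 𝓘 (F G)`. -/
def sliceMul (f g : ℍ[ℝ] → ℍ[ℝ]) : ℍ[ℝ] → ℍ[ℝ] := induce (fun z => stemOf f z * stemOf g z)

/-- The characteristic polynomial `Δ_q (x) = x² - x (q + qᶜ) + q qᶜ`. -/
def charPoly (q x : ℍ[ℝ]) : ℍ[ℝ] := x ^ 2 - x * (q + star q) + q * star q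

/-- The slice product `(x - q₁) · (x - q₂) · … · (x - qᵣ) · g`. -/
def linearFactors (qs : List ℍ[ℝ]) (g : ℍ[ℝ] → ℍ[ℝ]) : ℍ[ℝ] → ℍ[ℝ] :=
  qs.foldr (fun q h => sliceMul (fun x => x - q) h) g

/-- `f = Δ_q^m (x - q₁) · … · (x - qᵣ) · g` on `Ω_D`, with `q₁, …, qᵣ ∈ 𝕊_q`, no `qᵢ` the conjugate
of `qᵢ₊₁`, and `g` slice regular on `Ω_D` without zeros in `𝕊_q`.
(As `Δ_q^m` is slice preserving, its slice product with a function is the pointwise one.) -/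
def HasFactorization (D : Set ℂ) (f : ℍ[ℝ] → ℍ[ℝ]) (q : ℍ[ℝ]) (m : ℕ) (qs : List ℍ[ℝ]) : Prop :=
  (∀ p ∈ qs, p ∈ sphere q) ∧ qs.IsChain (fun a b => a ≠ star b) ∧
  ∃ g : ℍ[ℝ] → ℍ[ℝ], IsSliceRegular D g ∧ (∀ x ∈ sphere q, g x ≠ 0) ∧
    ∀ x ∈ circularization D, f x = charPoly q x ^ m * linearFactors qs g x

/-- `N` is a spherical multiplicity of `f` at `𝕊_q`. -/
def IsSphericalMultiplicity (D : Set ℂ) (f : ℍ[ℝ] → ℍ[ℝ]) (q : ℍ[ℝ]) (N : ℕ) : Prop :=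
  ∃ m qs, HasFactorization D f q m qs ∧ N = 2 * m

/-- `r` is an isolated multiplicity of `q` for `f`: the number of linear factors if the first of
them is `x - q`, and `0` if `x - q` is not the first linear factor. -/
def IsIsolatedMultiplicity (D : Set ℂ) (f : ℍ[ℝ] → ℍ[ℝ]) (q : ℍ[ℝ]) (r : ℕ) : Prop :=
  ∃ m qs, HasFactorization D f q m qs ∧
    ((qs.head? = some q ∧ r = qs.length) ∨ (qs.head? ≠ some q ∧ r = 0))

end SliceAnalysis

end

noncomputable section

namespace SliceAnalysis

/-! Everything is transported to the stem function F = F₀ + √-1 F₁ near z₀ = Re q₀ + i|Im q₀|.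

Write β = Im z. The spherical derivative has the stem function F₁/β with no √-1 part. Applying ∂/∂z
and the Cauchy–Riemann equations shows that ∂_c∂_s acts on the pair (F₀, F₁/β) as -(2β)⁻¹ ∂/∂β, that
is, as -d/d(β²) (`reIter_succ_eq_half_fderiv_imIter`, `csDeriv_slicePoint`). On the vertical line
through z₀, Δ is β₀² - β². So if F = Δ^m P, the iterates of order below m vanish at q₀, and the m-th
gives m! times the value of P (`csDeriv_eq_zero_of_lt`, `csDeriv_eq_factorial_smul`).

For P = (z - q₁)⋯(z - qᵣ)G as in a factorization, P(z₀) ≠ 0, and the slice function of P vanishes at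
a point of the sphere exactly when that point is q₁ (`linProd_mul_ne_zero_and_evalAt_eq_zero_iff`).
Hence m = n, and the criterion for q₀ follows.

Existence is an induction on the vanishing order at z₀ of the holomorphic function N(F), where N is
the complex norm form of ℍ ⊗ ℂ (`exists_hasStemFactorization`). N is multiplicative and N(z - q) =
Δ, so each factor split off lowers the order. The order is finite: a null element vanishes at some
imaginary unit, so N(F) ≡ 0 near z₀ would give zeros on all nearby spheres; on a slice domain it
would force F ≡ 0. -/

/-! ### The algebra ℍ ⊗ ℂ in components. -/

@[simp] lemma re_part0 (w : ℍ[ℂ]) : (part0 w).re = w.re.re := rfl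

@[simp] lemma imI_part0 (w : ℍ[ℂ]) : (part0 w).imI = w.imI.re := rfl

@[simp] lemma imJ_part0 (w : ℍ[ℂ]) : (part0 w).imJ = w.imJ.re := rfl

@[simp] lemma imK_part0 (w : ℍ[ℂ]) : (part0 w).imK = w.imK.re := rfl

@[simp] lemma re_part1 (w : ℍ[ℂ]) : (part1 w).re = w.re.im := rfl

@[simp] lemma imI_part1 (w : ℍ[ℂ]) : (part1 w).imI = w.imI.im := rfl

@[simp] lemma imJ_part1 (w : ℍ[ℂ]) : (part1 w).imJ = w.imJ.im := rfl

@[simp] lemma imK_part1 (w : ℍ[ℂ]) : (part1 w).imK = w.imK.im := rfl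

@[simp] lemma part0_ofParts (x y : ℍ[ℝ]) : part0 (ofParts x y) = x := rfl

@[simp] lemma part1_ofParts (x y : ℍ[ℝ]) : part1 (ofParts x y) = y := rfl

lemma ofParts_part (w : ℍ[ℂ]) : ofParts (part0 w) (part1 w) = w := rfl

lemma ext_part {w v : ℍ[ℂ]} (h0 : part0 w = part0 v) (h1 : part1 w = part1 v) : w = v := by
  rw [← ofParts_part w, ← ofParts_part v, h0, h1]

@[simp] lemma part0_zero : part0 0 = 0 := rfl

@[simp] lemma part1_zero : part1 0 = 0 := rfl

lemma part0_mul (w v : ℍ[ℂ]) : part0 (w * v) = part0 w * part0 v - part1 w * part1 v := by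
  ext <;> simp <;> ring

lemma part1_mul (w v : ℍ[ℂ]) : part1 (w * v) = part0 w * part1 v + part1 w * part0 v := by
  ext <;> simp <;> ring

lemma part0_smul (c : ℂ) (w : ℍ[ℂ]) : part0 (c • w) = c.re • part0 w - c.im • part1 w := by
  ext <;> simp

lemma part1_smul (c : ℂ) (w : ℍ[ℂ]) : part1 (c • w) = c.re • part1 w + c.im • part0 w := by
  ext <;> simp

/-- The value at `α + J β` of the slice function whose stem function has the value `w`
at `α + i β`. -/
def evalAt (J : ℍ[ℝ]) (w : ℍ[ℂ]) : ℍ[ℝ] := part0 w + J * part1 w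

/-- The conjugation of `ℍ ⊗ ℂ` with respect to the second factor. -/
def stemConj (w : ℍ[ℂ]) : ℍ[ℂ] := ofParts (part0 w) (-part1 w)

lemma stemConj_mul (w v : ℍ[ℂ]) : stemConj (w * v) = stemConj w * stemConj v := by
  apply ext_part <;> simp [stemConj, part0_mul, part1_mul]
  abel

lemma evalAt_neg_stemConj (J : ℍ[ℝ]) (w : ℍ[ℂ]) : evalAt (-J) (stemConj w) = evalAt J w := by
  simp [evalAt, stemConj]

/-! ### Imaginary units, slices and evaluation. -/

lemma mem_imagUnits {J : ℍ[ℝ]} : J ∈ imagUnits ↔ J * J = -1 := Iff.rfl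

lemma mem_imagUnits_iff {J : ℍ[ℝ]} :
    J ∈ imagUnits ↔ J.re = 0 ∧ J.imI ^ 2 + J.imJ ^ 2 + J.imK ^ 2 = 1 := by
  rw [mem_imagUnits, Quaternion.ext_iff]
  simp only [Quaternion.re_mul, Quaternion.imI_mul, Quaternion.imJ_mul, Quaternion.imK_mul,
    Quaternion.re_neg, Quaternion.imI_neg, Quaternion.imJ_neg, Quaternion.imK_neg,
    Quaternion.re_one, Quaternion.imI_one, Quaternion.imJ_one, Quaternion.imK_one]
  constructor
  · rintro ⟨h1, h2, h3, h4⟩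
    have hre : J.re = 0 := by
      by_contra hne
      have e2 : J.imI = 0 := by
        have : J.re * J.imI = 0 := by linarith
        simpa [hne] using this
      have e3 : J.imJ = 0 := by
        have : J.re * J.imJ = 0 := by linarith
        simpa [hne] using this
      have e4 : J.imK = 0 := by
        have : J.re * J.imK = 0 := by linarith
        simpa [hne] using this
      rw [e2, e3, e4] at h1
      nlinarith [mul_self_nonneg J.re]
    rw [hre] at h1
    exact ⟨hre, by linarith⟩
  · rintro ⟨h1, h2⟩
    rw [h1]
    refine ⟨by linarith, by ring, by ring, by ring⟩

lemma unitI_mem : unitI ∈ imagUnits := by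
  rw [mem_imagUnits_iff]; simp [unitI]

lemma neg_mem_imagUnits {J : ℍ[ℝ]} (hJ : J ∈ imagUnits) : -J ∈ imagUnits := by
  rw [mem_imagUnits] at *; simpa using hJ

lemma re_slicePoint {J : ℍ[ℝ]} (hJ : J ∈ imagUnits) (z : ℂ) : (slicePoint J z).re = z.re := by
  have := (mem_imagUnits_iff.1 hJ).1
  simp [slicePoint, this]

lemma im_slicePoint {J : ℍ[ℝ]} (hJ : J ∈ imagUnits) (z : ℂ) :
    (slicePoint J z).im = z.im • J := by
  have := (mem_imagUnits_iff.1 hJ).1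
  ext <;> simp [slicePoint, this] <;> rw [mul_comm]

lemma norm_of_mem_imagUnits {J : ℍ[ℝ]} (hJ : J ∈ imagUnits) : ‖J‖ = 1 := by
  have h : ‖J‖ * ‖J‖ = 1 := by
    rw [← norm_mul, mem_imagUnits.1 hJ]; simp
  nlinarith [norm_nonneg J]

lemma norm_im_slicePoint {J : ℍ[ℝ]} (hJ : J ∈ imagUnits) (z : ℂ) :
    ‖(slicePoint J z).im‖ = |z.im| := by
  rw [im_slicePoint hJ, norm_smul, norm_of_mem_imagUnits hJ]; simp

lemma slicePoint_star (J : ℍ[ℝ]) (z : ℂ) : slicePoint J (star z) = slicePoint (-J) z := by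
  simp [slicePoint]

lemma star_slicePoint {J : ℍ[ℝ]} (hJ : J ∈ imagUnits) (z : ℂ) :
    star (slicePoint J z) = slicePoint (-J) z := by
  have := (mem_imagUnits_iff.1 hJ).1
  ext <;> simp [slicePoint, this, mul_comm]

lemma coe_eq_smul_one (r : ℝ) : (r : ℍ[ℝ]) = r • (1 : ℍ[ℝ]) := by
  rw [← Quaternion.coe_mul_eq_smul, mul_one]

lemma slicePoint_eq (J : ℍ[ℝ]) (z : ℂ) :
    slicePoint J z = z.re • (1 : ℍ[ℝ]) + z.im • J := by
  rw [slicePoint, Quaternion.mul_coe_eq_smul, coe_eq_smul_one] 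

/-- Since J² = -1, evaluation at J turns the scalar √-1 into left multiplication by J. -/
lemma evalAt_smul {J : ℍ[ℝ]} (hJ : J ∈ imagUnits) (c : ℂ) (w : ℍ[ℂ]) :
    evalAt J (c • w) = slicePoint J c * evalAt J w := by
  have h : ∀ x : ℍ[ℝ], J * (J * x) = -x := fun x => by
    rw [← mul_assoc, mem_imagUnits.1 hJ]; simp
  simp only [evalAt, part0_smul, part1_smul, slicePoint_eq, add_mul, mul_add, smul_mul_assoc,
    mul_smul_comm, one_mul, h, smul_neg]
  abel

lemma slicePoint_mul {J : ℍ[ℝ]} (hJ : J ∈ imagUnits) (c d : ℂ) :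
    slicePoint J (c * d) = slicePoint J c * slicePoint J d := by
  simp only [slicePoint_eq, add_mul, mul_add, smul_mul_assoc,
    mul_smul_comm, one_mul, mul_one, mem_imagUnits.1 hJ, Complex.mul_re, Complex.mul_im, smul_neg]
  module

lemma slicePoint_pow {J : ℍ[ℝ]} (hJ : J ∈ imagUnits) (c : ℂ) (m : ℕ) :
    slicePoint J (c ^ m) = slicePoint J c ^ m := by
  induction m with
  | zero => simp [slicePoint]
  | succ k ih => rw [pow_succ, pow_succ, slicePoint_mul hJ, ih]

/-- The point `Re q + i |Im q|` of the complex plane. -/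
def planePoint (q : ℍ[ℝ]) : ℂ := ⟨q.re, ‖q.im‖⟩

/-- The stem function `(z - z₀) (z - conj z₀)` of a characteristic polynomial. -/
def quad (z₀ z : ℂ) : ℂ := (z - z₀) * (z - star z₀)

lemma norm_im_sq (q : ℍ[ℝ]) : ‖q.im‖ ^ 2 = q.imI ^ 2 + q.imJ ^ 2 + q.imK ^ 2 := by
  rw [sq, ← Quaternion.normSq_eq_norm_mul_self, Quaternion.normSq_def']; simp

lemma charPoly_slicePoint {J : ℍ[ℝ]} (hJ : J ∈ imagUnits) (q : ℍ[ℝ]) (z : ℂ) :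
    charPoly q (slicePoint J z) = slicePoint J (quad (planePoint q) z) := by
  have h1 : q + star q = ((2 * q.re : ℝ) : ℍ[ℝ]) := by
    rw [Quaternion.self_add_star q, two_mul, two_mul, Quaternion.coe_add]
  have h2 : q * star q = ((q.re ^ 2 + ‖q.im‖ ^ 2 : ℝ) : ℍ[ℝ]) := by
    rw [Quaternion.self_mul_star, Quaternion.normSq_def', norm_im_sq]; congr 1; ring
  have h3 : ∀ c : ℝ, (c : ℍ[ℝ]) = slicePoint J (c : ℂ) := fun c => by simp [slicePoint]
  have h4 : quad (planePoint q) z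
      = z ^ 2 - z * ((2 * q.re : ℝ) : ℂ) + ((q.re ^ 2 + ‖q.im‖ ^ 2 : ℝ) : ℂ) := by
    apply Complex.ext <;> simp [quad, planePoint, sq] <;> ring
  rw [charPoly, h1, h2, h3, h3, ← slicePoint_pow hJ, ← slicePoint_mul hJ, h4]
  simp only [slicePoint_eq, Complex.add_re, Complex.add_im, Complex.sub_re, Complex.sub_im]
  module

lemma exists_slicePoint {q : ℍ[ℝ]} (hq : q.im ≠ 0) :
    ∃ J ∈ imagUnits, q = slicePoint J (planePoint q) := by
  have hn : ‖q.im‖ ≠ 0 := norm_ne_zero_iff.2 hq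
  refine ⟨‖q.im‖⁻¹ • q.im, ?_, ?_⟩
  · rw [mem_imagUnits_iff]
    have := norm_im_sq q
    refine ⟨by simp, ?_⟩
    simp only [Quaternion.imI_smul, Quaternion.imJ_smul, Quaternion.imK_smul, Quaternion.imI_im,
      Quaternion.imJ_im, Quaternion.imK_im, smul_eq_mul, mul_pow]
    rw [← mul_add, ← mul_add, ← this]
    field_simp
  · rw [slicePoint_eq, planePoint]
    simp only [smul_smul, mul_inv_cancel₀ hn, one_smul]
    rw [← coe_eq_smul_one, Quaternion.re_add_im]

/-- Subtracting the two evaluations leaves (J - K) times the second part, and J - K is invertible.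
With v = 0: a nonzero value vanishes at no more than one unit. -/
lemma evalAt_injOn {w v : ℍ[ℂ]} {J K : ℍ[ℝ]} (hne : J ≠ K) (hJ : evalAt J w = evalAt J v)
    (hK : evalAt K w = evalAt K v) : w = v := by
  have h : (J - K) * (part1 w - part1 v) = 0 := by
    have : evalAt J w - evalAt K w = evalAt J v - evalAt K v := by rw [hJ, hK]
    simp only [evalAt] at this
    rw [sub_mul, mul_sub, mul_sub, ← sub_eq_zero.2 this]
    abel
  have h1 : part1 w = part1 v := by
    rcases mul_eq_zero.1 h with h | h
    · exact absurd (sub_eq_zero.1 h) hne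
    · exact sub_eq_zero.1 h
  refine ext_part ?_ h1
  simpa [evalAt, h1] using hJ

lemma ne_neg_of_mem_imagUnits {J : ℍ[ℝ]} (hJ : J ∈ imagUnits) : J ≠ -J := by
  intro h
  have h0 : J = 0 := by
    have : (2 : ℝ) • J = 0 := by rw [two_smul]; nth_rewrite 2 [h]; simp
    simpa using this
  have := norm_of_mem_imagUnits hJ
  simp [h0] at this

lemma ext_evalAt {w v : ℍ[ℂ]} (h : ∀ J ∈ imagUnits, evalAt J w = evalAt J v) : w = v :=
  evalAt_injOn (ne_neg_of_mem_imagUnits unitI_mem) (h _ unitI_mem)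
    (h _ (neg_mem_imagUnits unitI_mem))

/-! ### Linear factors, zero divisors and the norm form. -/

/-- The stem function `z - q`. -/
def linStem (q : ℍ[ℝ]) (z : ℂ) : ℍ[ℂ] := ofParts ((z.re : ℍ[ℝ]) - q) (z.im : ℍ[ℝ])

lemma linStem_mul_linStem_star (q : ℍ[ℝ]) (z : ℂ) (w : ℍ[ℂ]) :
    linStem q z * (linStem (star q) z * w) = quad (planePoint q) z • w := by
  have h := norm_im_sq q
  have e : star q = ((2 * q.re : ℝ) : ℍ[ℝ]) - q := by
    rw [eq_sub_iff_add_eq, Quaternion.star_add_self, two_mul, two_mul, Quaternion.coe_add]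
  have e2 : q * q = (2 * q.re) • q - (q.re ^ 2 + ‖q.im‖ ^ 2) • 1 := by
    ext <;> simp [h] <;> ring
  have e3 : ∀ x : ℍ[ℝ], q * (q * x) = (2 * q.re) • (q * x) - (q.re ^ 2 + ‖q.im‖ ^ 2) • x := by
    intro x
    rw [← mul_assoc, e2, sub_mul, smul_mul_assoc, smul_mul_assoc, one_mul]
  have c0 : (quad (planePoint q) z).re
      = z.re ^ 2 - z.im ^ 2 - 2 * q.re * z.re + q.re ^ 2 + ‖q.im‖ ^ 2 := by
    simp [quad, planePoint]; ring
  have c1 : (quad (planePoint q) z).im = 2 * z.im * (z.re - q.re) := by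
    simp [quad, planePoint]; ring
  apply ext_part
  · simp only [part0_mul, part1_mul, part0_smul, linStem, part0_ofParts, part1_ofParts, e, c0, c1,
      coe_eq_smul_one, mul_add, mul_sub, sub_mul, smul_mul_assoc, mul_smul_comm, one_mul, e3]
    module
  · simp only [part0_mul, part1_mul, part1_smul, linStem, part0_ofParts, part1_ofParts, e, c0, c1,
      coe_eq_smul_one, mul_add, mul_sub, sub_mul, smul_mul_assoc, mul_smul_comm, one_mul, e3]
    module

lemma planePoint_star (q : ℍ[ℝ]) : planePoint (star q) = planePoint q := by
  simp [planePoint]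

lemma linStem_star_mul_linStem (q : ℍ[ℝ]) (z : ℂ) (w : ℍ[ℂ]) :
    linStem (star q) z * (linStem q z * w) = quad (planePoint q) z • w := by
  have := linStem_mul_linStem_star (star q) z w
  rwa [star_star, planePoint_star] at this

lemma quad_self (z : ℂ) : quad z z = 0 := by simp [quad]

/-- At z, the factor z - conj q with q = α + Jβ is β(J + √-1), a zero divisor. Its product with w is
β(J e + √-1 e), where e is the evaluation of w at J. -/
lemma linStem_star_mul_eq_zero_iff {J : ℍ[ℝ]} (hJ : J ∈ imagUnits) {z : ℂ} (hz : z.im ≠ 0)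
    (w : ℍ[ℂ]) : linStem (star (slicePoint J z)) z * w = 0 ↔ evalAt J w = 0 := by
  have h : linStem (star (slicePoint J z)) z * w
      = ofParts (z.im • (J * evalAt J w)) (z.im • evalAt J w) := by
    have hJJ : ∀ x : ℍ[ℝ], J * (J * x) = -x := fun x => by
      rw [← mul_assoc, mem_imagUnits.1 hJ]; simp
    have e : (z.re : ℍ[ℝ]) - slicePoint (-J) z = z.im • J := by
      rw [slicePoint_eq, coe_eq_smul_one]; module
    rw [star_slicePoint hJ, linStem, e, coe_eq_smul_one z.im]
    apply ext_part
    · rw [part0_mul]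
      simp [evalAt, mul_add, hJJ]
      abel
    · rw [part1_mul]
      simp [evalAt]
      abel
  constructor
  · intro h0
    have := congrArg part1 (h.symm.trans h0)
    simpa [hz] using this
  · intro h0
    rw [h, h0]
    apply ext_part <;> simp

lemma normSq_eq_part (w : ℍ[ℂ]) :
    Quaternion.normSq w = ⟨Quaternion.normSq (part0 w) - Quaternion.normSq (part1 w),
      2 * ((part0 w) * star (part1 w)).re⟩ := by
  simp only [Quaternion.normSq_def']
  apply Complex.ext <;> simp [sq] <;> ring

/-- For w = a + √-1 b, nullity means |a| = |b| and Re(a b̄) = 0. If b ≠ 0, then -a b⁻¹ is an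
imaginary unit solving a + J b = 0. -/
lemma exists_evalAt_eq_zero {w : ℍ[ℂ]} (hw : Quaternion.normSq w = 0) :
    ∃ J ∈ imagUnits, evalAt J w = 0 := by
  rw [normSq_eq_part, Complex.ext_iff] at hw
  obtain ⟨h1, h2⟩ := hw
  simp only [Complex.zero_re, Complex.zero_im] at h1 h2
  set a := part0 w
  set b := part1 w
  by_cases hb : b = 0
  · have ha : a = 0 := by
      rw [hb] at h1
      simpa using h1
    exact ⟨unitI, unitI_mem, by change a + unitI * b = 0; simp [ha, hb]⟩
  · have hn : Quaternion.normSq b ≠ 0 := by simpa using hb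
    have hre : (a * star b).re = 0 := by linarith
    have hs : star (a * star b) = -(a * star b) := by
      have := Quaternion.star_add_self (a * star b)
      rw [hre] at this
      exact eq_neg_of_add_eq_zero_left (by simpa using this)
    refine ⟨-(a * b⁻¹), ?_, ?_⟩
    · have e : b⁻¹ = (Quaternion.normSq b)⁻¹ • star b := rfl
      rw [mem_imagUnits, e, mul_smul_comm, neg_mul_neg, smul_mul_smul_comm]
      have : (a * star b) * (a * star b) = -((Quaternion.normSq b ^ 2 : ℝ) : ℍ[ℝ]) := by
        have : (a * star b) * star (a * star b)
            = ((Quaternion.normSq b ^ 2 : ℝ) : ℍ[ℝ]) := by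
          rw [Quaternion.self_mul_star, map_mul, Quaternion.normSq_star, sq,
            sub_eq_zero.1 h1]
        rw [← this, hs]; simp
      rw [this, smul_neg, coe_eq_smul_one, smul_smul]
      field_simp
      simp
    · change a + -(a * b⁻¹) * b = 0
      rw [neg_mul, mul_assoc, inv_mul_cancel₀ hb]; simp

lemma planePoint_slicePoint {J : ℍ[ℝ]} (hJ : J ∈ imagUnits) {z : ℂ} (hz : 0 ≤ z.im) :
    planePoint (slicePoint J z) = z := by
  apply Complex.ext
  · exact re_slicePoint hJ z
  · exact (norm_im_slicePoint hJ z).trans (abs_of_nonneg hz)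

lemma slicePoint_left_injective {z : ℂ} (hz : z.im ≠ 0) {J K : ℍ[ℝ]}
    (h : slicePoint J z = slicePoint K z) : J = K := by
  simpa [slicePoint_eq, hz] using h

/-- The stem function of the product of the linear factors `x - q` for `q` in a list. -/
def linProd (qs : List ℍ[ℝ]) (z : ℂ) : ℍ[ℂ] := (qs.map fun q => linStem q z).prod

@[simp] lemma linProd_nil (z : ℂ) : linProd [] z = 1 := rfl

lemma linProd_cons_mul (q : ℍ[ℝ]) (qs : List ℍ[ℝ]) (z : ℂ) (w : ℍ[ℂ]) :
    linProd (q :: qs) z * w = linStem q z * (linProd qs z * w) := by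
  simp [linProd, mul_assoc]

@[simp] lemma evalAt_zero (J : ℍ[ℝ]) : evalAt J 0 = 0 := by simp [evalAt]

lemma zero_smul_stem (w : ℍ[ℂ]) : (0 : ℂ) • w = 0 := by
  apply Quaternion.ext <;> simp

/-- The factor z - q kills only values that vanish at conj q; by induction the remaining product
does so only if its first factor is z - conj q, which the chain condition excludes. The full product
vanishes at q because Δ(z) = 0 there, and nowhere else because it is nonzero. -/
lemma linProd_mul_ne_zero_and_evalAt_eq_zero_iff {z : ℂ} (hz : 0 < z.im) {w : ℍ[ℂ]}
    (hw : ∀ J ∈ imagUnits, evalAt J w ≠ 0) (qs : List ℍ[ℝ])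
    (hqs : ∀ p ∈ qs, ∃ J ∈ imagUnits, p = slicePoint J z)
    (hc : qs.IsChain fun a b => a ≠ star b) :
    linProd qs z * w ≠ 0 ∧
      ∀ J ∈ imagUnits, evalAt J (linProd qs z * w) = 0 ↔ qs.head? = some (slicePoint J z) := by
  induction qs with
  | nil =>
    refine ⟨fun h => hw _ unitI_mem ?_, fun J hJ => ?_⟩
    · rw [linProd_nil, one_mul] at h
      rw [h, evalAt_zero]
    · simp [hw J hJ]
  | cons q qs ih =>
    obtain ⟨-, ih2⟩ := ih (fun p hp => hqs p (List.mem_cons_of_mem _ hp)) hc.tail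
    obtain ⟨J, hJ, rfl⟩ := hqs q List.mem_cons_self
    rw [linProd_cons_mul]
    have hne : linStem (slicePoint J z) z * (linProd qs z * w) ≠ 0 := by
      intro h
      have e : slicePoint J z = star (slicePoint (-J) z) := by
        rw [star_slicePoint (neg_mem_imagUnits hJ), neg_neg]
      rw [e, linStem_star_mul_eq_zero_iff (neg_mem_imagUnits hJ) hz.ne',
        ih2 _ (neg_mem_imagUnits hJ)] at h
      cases qs with
      | nil => simp at h
      | cons p ps =>
        simp only [List.head?_cons, Option.some.injEq] at h
        have := (List.isChain_cons_cons.1 hc).1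
        rw [h] at this
        exact this e
    have h0 : evalAt J (linStem (slicePoint J z) z * (linProd qs z * w)) = 0 := by
      rw [← linStem_star_mul_eq_zero_iff hJ hz.ne', linStem_star_mul_linStem,
        planePoint_slicePoint hJ hz.le, quad_self, zero_smul_stem]
    refine ⟨hne, fun K hK => ?_⟩
    simp only [List.head?_cons, Option.some.injEq]
    constructor
    · intro h
      by_contra hJK
      exact hne (evalAt_injOn (v := 0) (fun e : J = K => hJK (by rw [e])) (by simpa using h0)
        (by simpa using h))
    · intro h
      rw [← slicePoint_left_injective hz.ne' h]
      exact h0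

lemma normSq_linStem (q : ℍ[ℝ]) (z : ℂ) :
    Quaternion.normSq (linStem q z) = quad (planePoint q) z := by
  have h := norm_im_sq q
  rw [normSq_eq_part]
  apply Complex.ext
  · simp [linStem, quad, planePoint, Quaternion.normSq_def']
    linear_combination -h
  · simp [linStem, quad, planePoint]
    ring

lemma normSq_smul_complex (c : ℂ) (w : ℍ[ℂ]) :
    Quaternion.normSq (c • w) = c ^ 2 * Quaternion.normSq w := by
  simp only [Quaternion.normSq_def', Quaternion.re_smul, Quaternion.imI_smul, Quaternion.imJ_smul,
    Quaternion.imK_smul, smul_eq_mul]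
  ring

/-! ### Holomorphic stem functions and division by Δ and by linear factors. -/

/-- Holomorphic stem functions. -/
def IsRegStem (D : Set ℂ) (F : ℂ → ℍ[ℂ]) : Prop := IsStem D F ∧ IsHolomorphicOn F D

lemma isStem_iff {D : Set ℂ} {F : ℂ → ℍ[ℂ]} :
    IsStem D F ↔ ∀ z ∈ D, F (star z) = stemConj (F z) := Iff.rfl

lemma IsStem.mul {D : Set ℂ} {F G : ℂ → ℍ[ℂ]} (hF : IsStem D F) (hG : IsStem D G) :
    IsStem D (fun z => F z * G z) := by
  rw [isStem_iff] at *
  intro z hz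
  simp only [hF z hz, hG z hz, stemConj_mul]

lemma isStem_linStem (D : Set ℂ) (q : ℍ[ℝ]) : IsStem D (linStem q) := by
  intro z _
  simp [linStem]

lemma quad_star (z₀ z : ℂ) : quad z₀ (star z) = star (quad z₀ z) := by
  simp [quad, mul_comm]

lemma IsStem.linProd_mul {D : Set ℂ} {G : ℂ → ℍ[ℂ]} (hG : IsStem D G) (qs : List ℍ[ℝ]) :
    IsStem D (fun z => linProd qs z * G z) := by
  induction qs with
  | nil => simpa using hG
  | cons q qs ih =>
    simp only [linProd_cons_mul]
    exact (isStem_linStem D q).mul ih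

lemma IsHolomorphicOn.mul {D : Set ℂ} {F G : ℂ → ℍ[ℂ]} (hF : IsHolomorphicOn F D)
    (hG : IsHolomorphicOn G D) : IsHolomorphicOn (fun z => F z * G z) D := by
  obtain ⟨f1, f2, f3, f4⟩ := hF
  obtain ⟨g1, g2, g3, g4⟩ := hG
  refine ⟨?_, ?_, ?_, ?_⟩ <;>
  simp only [Quaternion.re_mul, Quaternion.imI_mul, Quaternion.imJ_mul, Quaternion.imK_mul] <;>
  fun_prop

lemma isHolomorphicOn_linStem (D : Set ℂ) (q : ℍ[ℝ]) : IsHolomorphicOn (linStem q) D := by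
  have e1 : (fun z => (linStem q z).re) = fun z => z - (q.re : ℂ) := by
    funext z; apply Complex.ext <;> simp [linStem, ofParts]
  have e2 : (fun z => (linStem q z).imI) = fun _ => -(q.imI : ℂ) := by
    funext z; apply Complex.ext <;> simp [linStem, ofParts]
  have e3 : (fun z => (linStem q z).imJ) = fun _ => -(q.imJ : ℂ) := by
    funext z; apply Complex.ext <;> simp [linStem, ofParts]
  have e4 : (fun z => (linStem q z).imK) = fun _ => -(q.imK : ℂ) := by
    funext z; apply Complex.ext <;> simp [linStem, ofParts]
  unfold IsHolomorphicOn
  rw [e1, e2, e3, e4]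
  refine ⟨?_, ?_, ?_, ?_⟩ <;> fun_prop

lemma IsRegStem.linProd_mul {D : Set ℂ} {G : ℂ → ℍ[ℂ]} (hG : IsRegStem D G) (qs : List ℍ[ℝ]) :
    IsRegStem D (fun z => linProd qs z * G z) := by
  refine ⟨hG.1.linProd_mul qs, ?_⟩
  induction qs with
  | nil => simpa using hG.2
  | cons q qs ih =>
    simp only [linProd_cons_mul]
    exact (isHolomorphicOn_linStem D q).mul ih

lemma IsHolomorphicOn.normSq {D : Set ℂ} {F : ℂ → ℍ[ℂ]} (hF : IsHolomorphicOn F D) :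
    DifferentiableOn ℂ (fun z => Quaternion.normSq (F z)) D := by
  obtain ⟨f1, f2, f3, f4⟩ := hF
  simp only [Quaternion.normSq_def']
  fun_prop

lemma eventually_quad_ne_zero (z₀ z : ℂ) : ∀ᶠ w in 𝓝[≠] z, quad z₀ w ≠ 0 := by
  have h : ({z₀, star z₀} \ {z} : Set ℂ)ᶜ ∈ 𝓝 z :=
    (Set.toFinite ({z₀, star z₀} \ {z} : Set ℂ)).isClosed.isOpen_compl.mem_nhds (by simp)
  filter_upwards [mem_nhdsWithin_of_mem_nhds h, self_mem_nhdsWithin] with w hw hne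
  intro h0
  rcases mul_eq_zero.1 h0 with h0 | h0
  · exact hw ⟨Or.inl (sub_eq_zero.1 h0), hne⟩
  · exact hw ⟨Or.inr (sub_eq_zero.1 h0), hne⟩

/-- The zeros of Δ are isolated, so Δ may be cancelled off them and the equality extended by
continuity. -/
lemma eq_of_quad_mul_eq {D : Set ℂ} (hD : IsOpen D) {z₀ : ℂ} {φ ψ : ℂ → ℂ}
    (hφ : ContinuousOn φ D) (hψ : ContinuousOn ψ D)
    (h : ∀ z ∈ D, quad z₀ z * φ z = quad z₀ z * ψ z) : ∀ z ∈ D, φ z = ψ z := by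
  intro z hz
  have hDz := hD.mem_nhds hz
  refine ((ContinuousAt.eventuallyEq_nhds_iff_eventuallyEq_nhdsNE
    (hφ.continuousAt hDz) (hψ.continuousAt hDz)).1 ?_).eq_of_nhds
  filter_upwards [eventually_quad_ne_zero z₀ z, mem_nhdsWithin_of_mem_nhds hDz] with w hw hwD
  exact mul_left_cancel₀ hw (h w hwD)

lemma eq_of_quad_smul_eq {D : Set ℂ} (hD : IsOpen D) {z₀ : ℂ} {F G : ℂ → ℍ[ℂ]}
    (hF : IsHolomorphicOn F D) (hG : IsHolomorphicOn G D)
    (h : ∀ z ∈ D, quad z₀ z • F z = quad z₀ z • G z) : ∀ z ∈ D, F z = G z := by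
  obtain ⟨f1, f2, f3, f4⟩ := hF
  obtain ⟨g1, g2, g3, g4⟩ := hG
  intro z hz
  apply Quaternion.ext
  · exact eq_of_quad_mul_eq hD f1.continuousOn g1.continuousOn
      (fun z hz => by simpa using congrArg (·.re) (h z hz)) z hz
  · exact eq_of_quad_mul_eq hD f2.continuousOn g2.continuousOn
      (fun z hz => by simpa using congrArg (·.imI) (h z hz)) z hz
  · exact eq_of_quad_mul_eq hD f3.continuousOn g3.continuousOn
      (fun z hz => by simpa using congrArg (·.imJ) (h z hz)) z hz
  · exact eq_of_quad_mul_eq hD f4.continuousOn g4.continuousOn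
      (fun z hz => by simpa using congrArg (·.imK) (h z hz)) z hz

lemma exists_eq_quad_mul {D : Set ℂ} (hD : IsOpen D) (hsymm : ∀ z ∈ D, star z ∈ D) {z₀ : ℂ}
    (hz₀ : z₀ ∈ D) (him : z₀.im ≠ 0) {φ : ℂ → ℂ} (hφ : DifferentiableOn ℂ φ D)
    (h1 : φ z₀ = 0) (h2 : φ (star z₀) = 0) :
    ∃ ψ : ℂ → ℂ, DifferentiableOn ℂ ψ D ∧ ∀ z, φ z = quad z₀ z * ψ z := by
  have hne : star z₀ - z₀ ≠ 0 := by
    intro h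
    have := congrArg Complex.im h
    simp at this
    exact him (by linarith)
  have hg := (Complex.differentiableOn_dslope (hD.mem_nhds hz₀)).2 hφ
  have hg1 : ∀ z, φ z = (z - z₀) * dslope φ z₀ z := fun z => by
    have := sub_smul_dslope φ z₀ z
    rw [h1, sub_zero, smul_eq_mul] at this
    exact this.symm
  have hg2 : dslope φ z₀ (star z₀) = 0 := by
    have := hg1 (star z₀)
    rw [h2] at this
    exact (mul_eq_zero.1 this.symm).resolve_left hne
  -- Dividing out the two distinct roots in turn; `dslope` fills in the removable singularities.
  refine ⟨dslope (dslope φ z₀) (star z₀),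
    (Complex.differentiableOn_dslope (hD.mem_nhds (hsymm _ hz₀))).2 hg, fun z => ?_⟩
  have := sub_smul_dslope (dslope φ z₀) (star z₀) z
  rw [hg2, sub_zero, smul_eq_mul] at this
  rw [quad, mul_assoc, this, ← hg1]

lemma star_eq_of_quad {D : Set ℂ} (hD : IsOpen D) (hsymm : ∀ z ∈ D, star z ∈ D) {z₀ : ℂ}
    {φ ψ : ℂ → ℂ} (hψ : DifferentiableOn ℂ ψ D) (h : ∀ z, φ z = quad z₀ z * ψ z)
    (hφ : ∀ z ∈ D, φ (star z) = star (φ z)) : ∀ z ∈ D, ψ (star z) = star (ψ z) := by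
  have key : ∀ z ∈ D, ψ z = star (ψ (star z)) := by
    refine eq_of_quad_mul_eq (z₀ := z₀) hD hψ.continuousOn (continuous_star.comp_continuousOn
      (hψ.continuousOn.comp continuous_star.continuousOn hsymm)) fun z hz => ?_
    rw [← h, ← star_star z, hφ _ (hsymm z hz), star_star, h, star_mul', ← quad_star, star_star]
  intro z hz
  rw [key z hz, star_star]

lemma isStem_iff_components {D : Set ℂ} {F : ℂ → ℍ[ℂ]} :
    IsStem D F ↔ (∀ z ∈ D, (F (star z)).re = star (F z).re) ∧
      (∀ z ∈ D, (F (star z)).imI = star (F z).imI) ∧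
      (∀ z ∈ D, (F (star z)).imJ = star (F z).imJ) ∧
      (∀ z ∈ D, (F (star z)).imK = star (F z).imK) := by
  constructor
  · intro h
    refine ⟨?_, ?_, ?_, ?_⟩ <;> intro z hz <;> rw [h z hz] <;> rfl
  · rintro ⟨h1, h2, h3, h4⟩ z hz
    exact Quaternion.ext_iff.2 ⟨h1 z hz, h2 z hz, h3 z hz, h4 z hz⟩

/-- The stem symmetry carries the zero at z₀ to conj z₀, so each component is divisible by both
roots of Δ. -/
lemma IsRegStem.exists_eq_quad_smul {D : Set ℂ} (hD : IsOpen D) (hsymm : ∀ z ∈ D, star z ∈ D)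
    {z₀ : ℂ} (hz₀ : z₀ ∈ D) (him : z₀.im ≠ 0) {F : ℂ → ℍ[ℂ]} (hF : IsRegStem D F)
    (h0 : F z₀ = 0) : ∃ H, IsRegStem D H ∧ ∀ z ∈ D, F z = quad z₀ z • H z := by
  obtain ⟨hs, f1, f2, f3, f4⟩ := hF
  obtain ⟨s1, s2, s3, s4⟩ := isStem_iff_components.1 hs
  obtain ⟨ψ1, d1, e1⟩ := exists_eq_quad_mul hD hsymm hz₀ him f1 (by simp [h0])
    (by rw [s1 _ hz₀]; simp [h0])
  obtain ⟨ψ2, d2, e2⟩ := exists_eq_quad_mul hD hsymm hz₀ him f2 (by simp [h0])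
    (by rw [s2 _ hz₀]; simp [h0])
  obtain ⟨ψ3, d3, e3⟩ := exists_eq_quad_mul hD hsymm hz₀ him f3 (by simp [h0])
    (by rw [s3 _ hz₀]; simp [h0])
  obtain ⟨ψ4, d4, e4⟩ := exists_eq_quad_mul hD hsymm hz₀ him f4 (by simp [h0])
    (by rw [s4 _ hz₀]; simp [h0])
  exact ⟨fun z => ⟨ψ1 z, ψ2 z, ψ3 z, ψ4 z⟩, ⟨isStem_iff_components.2
    ⟨star_eq_of_quad hD hsymm d1 e1 s1, star_eq_of_quad hD hsymm d2 e2 s2,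
      star_eq_of_quad hD hsymm d3 e3 s3, star_eq_of_quad hD hsymm d4 e4 s4⟩, d1, d2, d3, d4⟩,
    fun z _ => Quaternion.ext_iff.2 ⟨e1 z, e2 z, e3 z, e4 z⟩⟩

lemma isRegStem_linStem (D : Set ℂ) (q : ℍ[ℝ]) : IsRegStem D (linStem q) :=
  ⟨isStem_linStem D q, isHolomorphicOn_linStem D q⟩

lemma IsRegStem.mul {D : Set ℂ} {F G : ℂ → ℍ[ℂ]} (hF : IsRegStem D F) (hG : IsRegStem D G) :
    IsRegStem D (fun z => F z * G z) := ⟨hF.1.mul hG.1, hF.2.mul hG.2⟩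

lemma mul_smul_stem (c : ℂ) (w v : ℍ[ℂ]) : w * (c • v) = c • (w * v) := by
  apply Quaternion.ext <;> simp <;> ring

/-- The product (z - conj q)F vanishes at z₀, hence equals ΔH. Multiplying by z - q on the left and
cancelling Δ gives F = (z - q)H. -/
lemma IsRegStem.exists_eq_linStem_mul {D : Set ℂ} (hD : IsOpen D) (hsymm : ∀ z ∈ D, star z ∈ D)
    {z₀ : ℂ} (hz₀ : z₀ ∈ D) (him : 0 < z₀.im) {F : ℂ → ℍ[ℂ]} (hF : IsRegStem D F)
    {J : ℍ[ℝ]} (hJ : J ∈ imagUnits) (h0 : evalAt J (F z₀) = 0) :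
    ∃ H, IsRegStem D H ∧ ∀ z ∈ D, F z = linStem (slicePoint J z₀) z * H z := by
  set q := slicePoint J z₀ with hq
  have hpq : planePoint q = z₀ := planePoint_slicePoint hJ him.le
  obtain ⟨H, hH, hFH⟩ := ((isRegStem_linStem D (star q)).mul hF).exists_eq_quad_smul hD hsymm hz₀
    him.ne' ((linStem_star_mul_eq_zero_iff hJ him.ne' _).2 h0)
  refine ⟨H, hH, eq_of_quad_smul_eq (z₀ := z₀) hD hF.2 ((isRegStem_linStem D q).mul hH).2
    fun z hz => ?_⟩
  rw [← mul_smul_stem, ← hFH z hz, linStem_mul_linStem_star, hpq]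

/-- Orders add and Δ vanishes at z₀: this is the descent step for the induction on the order of the
norm. -/
lemma quad_ne_zero_of_order {D : Set ℂ} (hD : IsOpen D) {z₀ : ℂ} (hz₀ : z₀ ∈ D) {k : ℕ} {a : ℕ}
    (ha : a ≠ 0) {φ ψ : ℂ → ℂ} (hψ : DifferentiableOn ℂ ψ D)
    (h : ∀ z ∈ D, φ z = quad z₀ z ^ a * ψ z) (hk : analyticOrderAt φ z₀ = k) :
    ∃ l < k, analyticOrderAt ψ z₀ = (l : ℕ) := by
  have hq : AnalyticAt ℂ (quad z₀) z₀ := by unfold quad; fun_prop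
  have hψ' : AnalyticAt ℂ ψ z₀ := hψ.analyticAt (hD.mem_nhds hz₀)
  have e : analyticOrderAt φ z₀ = analyticOrderAt (quad z₀ ^ a) z₀ + analyticOrderAt ψ z₀ := by
    rw [← analyticOrderAt_mul (hq.pow a) hψ']
    exact analyticOrderAt_congr (Filter.eventually_of_mem (hD.mem_nhds hz₀) h)
  have h1 : analyticOrderAt (quad z₀ ^ a) z₀ ≠ 0 := by
    rw [(hq.pow a).analyticOrderAt_ne_zero]
    simp [quad_self, ha]
  rw [hk] at e
  have hψt : analyticOrderAt ψ z₀ ≠ ⊤ := fun h => by simp [h] at e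
  have hqt : analyticOrderAt (quad z₀ ^ a) z₀ ≠ ⊤ := fun h => by simp [h] at e
  obtain ⟨l, hl⟩ := ENat.ne_top_iff_exists.1 hψt
  obtain ⟨b, hb⟩ := ENat.ne_top_iff_exists.1 hqt
  rw [← hl, ← hb] at e
  rw [← hb] at h1
  refine ⟨l, ?_, hl.symm⟩
  have h2 : k = b + l := by exact_mod_cast e
  have h3 : b ≠ 0 := by exact_mod_cast h1
  omega

/-! ### Existence of the factorization. -/

/-- `F = Δ^m (z - q₁) ⋯ (z - qᵣ) G` on `D`, in terms of stem functions. -/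
def HasStemFactorization (D : Set ℂ) (F : ℂ → ℍ[ℂ]) (z₀ : ℂ) (m : ℕ) (qs : List ℍ[ℝ]) : Prop :=
  (∀ p ∈ qs, ∃ J ∈ imagUnits, p = slicePoint J z₀) ∧ qs.IsChain (fun a b => a ≠ star b) ∧
  ∃ G, IsRegStem D G ∧ (∀ J ∈ imagUnits, evalAt J (G z₀) ≠ 0) ∧
    ∀ z ∈ D, F z = quad z₀ z ^ m • (linProd qs z * G z)

lemma one_smul_stem (w : ℍ[ℂ]) : (1 : ℂ) • w = w := by
  apply Quaternion.ext <;> simp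

lemma smul_smul_stem (c d : ℂ) (w : ℍ[ℂ]) : c • d • w = (c * d) • w := by
  apply Quaternion.ext <;> simp [mul_assoc]

theorem exists_hasStemFactorization {D : Set ℂ} (hD : IsOpen D) (hsymm : ∀ z ∈ D, star z ∈ D)
    {z₀ : ℂ} (hz₀ : z₀ ∈ D) (him : 0 < z₀.im) (k : ℕ) (F : ℂ → ℍ[ℂ]) (hF : IsRegStem D F)
    (hk : analyticOrderAt (fun z => Quaternion.normSq (F z)) z₀ = k) :
    ∃ m qs, HasStemFactorization D F z₀ m qs := by
  induction k using Nat.strong_induction_on generalizing F with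
  | _ k ih =>
  by_cases h0 : F z₀ = 0
  · obtain ⟨H, hH, hFH⟩ := hF.exists_eq_quad_smul hD hsymm hz₀ him.ne' h0
    obtain ⟨l, hl, hlH⟩ := quad_ne_zero_of_order hD hz₀ two_ne_zero hH.2.normSq
      (fun z hz => by rw [hFH z hz, normSq_smul_complex]) hk
    obtain ⟨m, qs, h1, h2, G, hG, hG0, hHG⟩ := ih l hl H hH hlH
    refine ⟨m + 1, qs, h1, h2, G, hG, hG0, fun z hz => ?_⟩
    rw [hFH z hz, hHG z hz, smul_smul_stem, pow_succ']
  by_cases h1 : ∃ J ∈ imagUnits, evalAt J (F z₀) = 0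
  · obtain ⟨J, hJ, hJ0⟩ := h1
    obtain ⟨H, hH, hFH⟩ := hF.exists_eq_linStem_mul hD hsymm hz₀ him hJ hJ0
    obtain ⟨l, hl, hlH⟩ := quad_ne_zero_of_order hD hz₀ one_ne_zero hH.2.normSq
      (fun z hz => by
        rw [hFH z hz, map_mul, normSq_linStem, planePoint_slicePoint hJ him.le, pow_one]) hk
    obtain ⟨m, qs, h1, h2, G, hG, hG0, hHG⟩ := ih l hl H hH hlH
    -- Spherical zeros were removed first, so F z₀ ≠ 0 here and H has no factor Δ.
    have hm : m = 0 := by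
      by_contra hm
      apply h0
      rw [hFH z₀ hz₀, hHG z₀ hz₀, quad_self, zero_pow hm, zero_smul_stem, mul_zero]
    subst hm
    simp only [pow_zero, one_smul_stem] at hHG
    refine ⟨0, slicePoint J z₀ :: qs, ?_, ?_, G, hG, hG0, fun z hz => ?_⟩
    · intro p hp
      rcases List.mem_cons.1 hp with rfl | hp
      · exact ⟨J, hJ, rfl⟩
      · exact h1 p hp
    · cases qs with
      | nil => simp
      | cons p ps =>
        -- If the next factor were z - conj q, the two would multiply to Δ and force F z₀ = 0.
        refine List.isChain_cons_cons.2 ⟨fun e => h0 ?_, h2⟩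
        have e' : p = star (slicePoint J z₀) := by rw [e, star_star]
        rw [hFH z₀ hz₀, hHG z₀ hz₀, linProd_cons_mul, e', linStem_mul_linStem_star,
          planePoint_slicePoint hJ him.le, quad_self, zero_smul_stem]
    · rw [hFH z hz, hHG z hz, pow_zero, one_smul_stem, linProd_cons_mul]
  · push Not at h1
    refine ⟨0, [], by simp, by simp, F, hF, h1, fun z _ => ?_⟩
    rw [pow_zero, one_smul_stem, linProd_nil, one_mul]

/-! ### Dictionary between slice functions and stem functions. -/

lemma slicePoint_mem_circularization {D : Set ℂ} {z : ℂ} (hz : z ∈ D) {J : ℍ[ℝ]}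
    (hJ : J ∈ imagUnits) : slicePoint J z ∈ circularization D := ⟨z, hz, J, hJ, rfl⟩

lemma IsInducedBy.eqOn {D : Set ℂ} {F G : ℂ → ℍ[ℂ]} {f : ℍ[ℝ] → ℍ[ℝ]} (hF : IsInducedBy D F f)
    (hG : IsInducedBy D G f) : ∀ z ∈ D, F z = G z := fun z hz =>
  ext_evalAt fun J hJ => (hF z hz J hJ).symm.trans (hG z hz J hJ)

lemma stemOf_eq_of_slicePoint {f : ℍ[ℝ] → ℍ[ℝ]} {z : ℂ} {x y : ℍ[ℝ]}
    (h : ∀ J ∈ imagUnits, f (slicePoint J z) = x + J * y) : stemOf f z = ofParts x y := by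
  rw [stemOf, h _ unitI_mem, h _ (neg_mem_imagUnits unitI_mem)]
  congr 1
  · rw [neg_mul, add_add_add_comm, add_neg_cancel, add_zero, ← two_smul ℝ, smul_smul]
    norm_num
  · have : x + unitI * y - (x + -unitI * y) = (2 : ℝ) • (unitI * y) := by
      rw [two_smul, neg_mul]; abel
    rw [this, smul_smul, mul_smul_comm, ← mul_assoc, neg_mul, mem_imagUnits.1 unitI_mem]
    norm_num

lemma IsInducedBy.stemOf_eq {D : Set ℂ} {F : ℂ → ℍ[ℂ]} {f : ℍ[ℝ] → ℍ[ℝ]}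
    (hF : IsInducedBy D F f) : ∀ z ∈ D, stemOf f z = F z := fun z hz =>
  stemOf_eq_of_slicePoint (hF z hz)

lemma induce_slicePoint {J : ℍ[ℝ]} (hJ : J ∈ imagUnits) (F : ℂ → ℍ[ℂ]) {z : ℂ} (hz : 0 < z.im) :
    induce F (slicePoint J z) = evalAt J (F z) := by
  have hp : (⟨(slicePoint J z).re, ‖(slicePoint J z).im‖⟩ : ℂ) = z :=
    planePoint_slicePoint hJ hz.le
  have hn : ‖(slicePoint J z).im‖ = z.im := by rw [norm_im_slicePoint hJ, abs_of_pos hz]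
  rw [induce, hp, hn, im_slicePoint hJ, smul_smul, inv_mul_cancel₀ hz.ne', one_smul, evalAt]

lemma IsStem.part1_eq_zero {D : Set ℂ} {F : ℂ → ℍ[ℂ]} (hF : IsStem D F) {z : ℂ} (hz : z ∈ D)
    (h : z.im = 0) : part1 (F z) = 0 := by
  have hz' : star z = z := by apply Complex.ext <;> simp [h]
  have := congrArg part1 (hF z hz)
  rw [hz', part1_ofParts] at this
  have h2 : (2 : ℝ) • part1 (F z) = 0 := by
    rw [two_smul]; nth_rewrite 2 [this]; simp
  simpa using h2

/-- `induce` reads F only at Im z ≥ 0. Below the real axis the stem symmetry replaces (J, z) by (-J,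
conj z); on it F₁ = 0. -/
lemma IsStem.isInducedBy_induce {D : Set ℂ} {F : ℂ → ℍ[ℂ]}
    (hF : IsStem D F) : IsInducedBy D F (induce F) := by
  intro z hz J hJ
  change _ = evalAt J (F z)
  rcases lt_trichotomy z.im 0 with h | h | h
  · have e : slicePoint J z = slicePoint (-J) (star z) := by
      rw [slicePoint_star, neg_neg]
    rw [e, induce_slicePoint (neg_mem_imagUnits hJ) _ (by simpa using h), isStem_iff.1 hF z hz,
      evalAt_neg_stemConj]
  · have h1 := hF.part1_eq_zero hz h
    have hp : (⟨(slicePoint J z).re, ‖(slicePoint J z).im‖⟩ : ℂ) = z :=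
      planePoint_slicePoint hJ h.ge
    rw [induce, hp, h1, evalAt, h1, mul_zero, mul_zero]
  · exact induce_slicePoint hJ F h

lemma IsInducedBy.congr {D : Set ℂ} {F G : ℂ → ℍ[ℂ]} {f : ℍ[ℝ] → ℍ[ℝ]}
    (hF : IsInducedBy D F f) (h : ∀ z ∈ D, G z = F z) : IsInducedBy D G f := by
  intro z hz J hJ
  rw [h z hz]
  exact hF z hz J hJ

lemma IsStem.congr {D : Set ℂ} (hsymm : ∀ z ∈ D, star z ∈ D) {F G : ℂ → ℍ[ℂ]} (hF : IsStem D F)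
    (h : ∀ z ∈ D, G z = F z) : IsStem D G := by
  intro z hz
  rw [h z hz, h _ (hsymm z hz)]
  exact hF z hz

lemma IsInducedBy.sliceMul {D : Set ℂ} (hsymm : ∀ z ∈ D, star z ∈ D) {F G : ℂ → ℍ[ℂ]}
    {f g : ℍ[ℝ] → ℍ[ℝ]} (hF : IsStem D F) (hG : IsStem D G) (hf : IsInducedBy D F f)
    (hg : IsInducedBy D G g) : IsInducedBy D (fun z => F z * G z) (sliceMul f g) := by
  have h : ∀ z ∈ D, stemOf f z * stemOf g z = F z * G z := fun z hz => by
    rw [hf.stemOf_eq z hz, hg.stemOf_eq z hz]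
  exact (((hF.mul hG).congr hsymm h).isInducedBy_induce).congr fun z hz => (h z hz).symm

lemma isInducedBy_sub (D : Set ℂ) (q : ℍ[ℝ]) : IsInducedBy D (linStem q) (fun x => x - q) := by
  intro z _ J _
  simp only [slicePoint, linStem, part0_ofParts, part1_ofParts]
  abel

lemma IsInducedBy.linearFactors {D : Set ℂ} (hsymm : ∀ z ∈ D, star z ∈ D) {G : ℂ → ℍ[ℂ]}
    {g : ℍ[ℝ] → ℍ[ℝ]} (hG : IsStem D G) (hg : IsInducedBy D G g) (qs : List ℍ[ℝ]) :
    IsInducedBy D (fun z => linProd qs z * G z) (linearFactors qs g) := by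
  induction qs with
  | nil => simpa [SliceAnalysis.linearFactors] using hg
  | cons q qs ih =>
    simp only [linProd_cons_mul]
    exact IsInducedBy.sliceMul hsymm (isStem_linStem D q) (hG.linProd_mul qs)
      (isInducedBy_sub D q) ih

lemma IsInducedBy.charPoly_pow_mul {D : Set ℂ} {H : ℂ → ℍ[ℂ]} {h : ℍ[ℝ] → ℍ[ℝ]}
    (hH : IsInducedBy D H h) (q : ℍ[ℝ]) (m : ℕ) :
    IsInducedBy D (fun z => quad (planePoint q) z ^ m • H z) (fun x => charPoly q x ^ m * h x) := by
  intro z hz J hJ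
  change charPoly q (slicePoint J z) ^ m * h (slicePoint J z)
    = evalAt J (quad (planePoint q) z ^ m • H z)
  rw [charPoly_slicePoint hJ, evalAt_smul hJ, slicePoint_pow hJ, hH z hz J hJ]
  rfl

lemma hasFactorization_iff {D : Set ℂ} (hsymm : ∀ z ∈ D, star z ∈ D) {F : ℂ → ℍ[ℂ]}
    {f : ℍ[ℝ] → ℍ[ℝ]} (hFf : IsInducedBy D F f) {q : ℍ[ℝ]}
    (hq : planePoint q ∈ D) (m : ℕ) (qs : List ℍ[ℝ]) :
    HasFactorization D f q m qs ↔ HasStemFactorization D F (planePoint q) m qs := by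
  refine and_congr Iff.rfl (and_congr Iff.rfl ⟨?_, ?_⟩)
  · rintro ⟨g, ⟨G, hGs, hGh, hGi⟩, hg0, hfg⟩
    refine ⟨G, ⟨hGs, hGh⟩, fun J hJ h => hg0 _ ⟨J, hJ, rfl⟩ ((hGi _ hq J hJ).trans h), ?_⟩
    refine hFf.eqOn fun z hz J hJ => ?_
    rw [hfg _ (slicePoint_mem_circularization hz hJ)]
    exact (hGi.linearFactors hsymm hGs qs).charPoly_pow_mul q m z hz J hJ
  · rintro ⟨G, ⟨hGs, hGh⟩, hG0, hFG⟩
    have hGi := hGs.isInducedBy_induce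
    refine ⟨induce G, ⟨G, hGs, hGh, hGi⟩, ?_, ?_⟩
    · rintro x ⟨J, hJ, rfl⟩ h
      exact hG0 J hJ ((hGi _ hq J hJ).symm.trans h)
    · rintro x ⟨z, hz, J, hJ, rfl⟩
      rw [hFf z hz J hJ, hFG z hz]
      exact ((hGi.linearFactors hsymm hGs qs).charPoly_pow_mul q m z hz J hJ).symm

/-! ### The operator -d/d(β²) on one real variable. -/

/-- The operator `-(2β)⁻¹ d/dβ`, i.e. `-d/ds` with `s = β²`, on functions of one real variable. -/
def sqDeriv (g : ℝ → ℝ) (t : ℝ) : ℝ := -(2 * t)⁻¹ * deriv g t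

lemma sqDeriv_congr {g h : ℝ → ℝ} {b : ℝ} (e : g =ᶠ[𝓝 b] h) : sqDeriv g =ᶠ[𝓝 b] sqDeriv h := by
  filter_upwards [e.deriv] with t ht
  rw [sqDeriv, ht, sqDeriv]

lemma exists_iterate_sqDeriv_eventuallyEq {b : ℝ} (hb : b ≠ 0) {g p : ℝ → ℝ} {m : ℕ}
    (hp : AnalyticAt ℝ p b) (hg : g =ᶠ[𝓝 b] fun t => (b ^ 2 - t ^ 2) ^ m * p t) {j : ℕ}
    (hj : j ≤ m) : ∃ r : ℝ → ℝ, AnalyticAt ℝ r b ∧ r b = m.descFactorial j * p b ∧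
      sqDeriv^[j] g =ᶠ[𝓝 b] fun t => (b ^ 2 - t ^ 2) ^ (m - j) * r t := by
  induction j with
  | zero => exact ⟨p, hp, by simp, by simpa using hg⟩
  | succ j ih =>
    obtain ⟨r, hr, hrb, hrg⟩ := ih (by omega)
    obtain ⟨i, hi⟩ : ∃ i, m - j = i + 1 := ⟨m - j - 1, by omega⟩
    have hi' : m - (j + 1) = i := by omega
    -- The product rule with (b² - t²)^i taken out; the second term vanishes at b.
    refine ⟨fun t => (i + 1) * r t - (b ^ 2 - t ^ 2) * (2 * t)⁻¹ * deriv r t, ?_, ?_, ?_⟩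
    · have h2 : AnalyticAt ℝ (fun t : ℝ => (2 * t)⁻¹) b :=
        AnalyticAt.inv (by fun_prop) (by simpa using hb)
      have h3 := hr.deriv
      fun_prop
    · rw [Nat.descFactorial_succ, hi]
      push_cast
      rw [sub_self, hrb]
      ring
    · rw [Function.iterate_succ_apply', hi']
      refine (sqDeriv_congr hrg).trans ?_
      filter_upwards [hr.eventually_analyticAt, eventually_ne_nhds hb] with t ht ht0
      have h1 : HasDerivAt (fun t : ℝ => b ^ 2 - t ^ 2) (-(2 * t)) t := by
        simpa using (hasDerivAt_pow 2 t).const_sub (b ^ 2)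
      have h2 := (h1.pow (i + 1)).mul ht.differentiableAt.hasDerivAt
      have h3 : deriv (fun t => (b ^ 2 - t ^ 2) ^ (m - j) * r t) t
          = ((i + 1 : ℕ) : ℝ) * (b ^ 2 - t ^ 2) ^ i * -(2 * t) * r t
            + (b ^ 2 - t ^ 2) ^ (i + 1) * deriv r t := by
        rw [hi]; exact h2.deriv
      rw [sqDeriv, h3]
      push_cast
      field_simp
      ring

lemma iterate_sqDeriv_eq_zero {b : ℝ} (hb : b ≠ 0) {g p : ℝ → ℝ} {m : ℕ}
    (hp : AnalyticAt ℝ p b) (hg : g =ᶠ[𝓝 b] fun t => (b ^ 2 - t ^ 2) ^ m * p t) {j : ℕ}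
    (hj : j < m) : sqDeriv^[j] g b = 0 := by
  obtain ⟨r, -, -, h⟩ := exists_iterate_sqDeriv_eventuallyEq hb hp hg hj.le
  rw [h.eq_of_nhds, sub_self, zero_pow (by omega), zero_mul]

lemma iterate_sqDeriv_eq_factorial_mul {b : ℝ} (hb : b ≠ 0) {g p : ℝ → ℝ} {m : ℕ}
    (hp : AnalyticAt ℝ p b) (hg : g =ᶠ[𝓝 b] fun t => (b ^ 2 - t ^ 2) ^ m * p t) :
    sqDeriv^[m] g b = m.factorial * p b := by
  obtain ⟨r, -, hr, h⟩ := exists_iterate_sqDeriv_eventuallyEq hb hp hg le_rfl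
  rw [h.eq_of_nhds, Nat.sub_self, pow_zero, one_mul, hr, Nat.descFactorial_self]

/-! ### The operator -(2β)⁻¹ ∂/∂β in the upper half plane. -/

/-- The operator `-(2β)⁻¹ ∂/∂β` on functions of `z = α + i β`. -/
def imSqDeriv (u : ℂ → ℝ) (z : ℂ) : ℝ := -(2 * z.im)⁻¹ * fderiv ℝ u z Complex.I

lemma analyticOnNhd_im_inv : AnalyticOnNhd ℝ (fun z : ℂ => (z.im)⁻¹) {z | 0 < z.im} :=
  fun z hz => AnalyticAt.inv (Complex.imCLM.analyticAt z) (ne_of_gt hz)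

lemma analyticOnNhd_fderiv_apply {u : ℂ → ℝ} {E : Set ℂ} (hu : AnalyticOnNhd ℝ u E) (v : ℂ) :
    AnalyticOnNhd ℝ (fun z => fderiv ℝ u z v) E := fun z hz =>
  ((ContinuousLinearMap.apply ℝ ℝ v).analyticAt _).comp (hu z hz).fderiv

lemma AnalyticOnNhd.imSqDeriv {u : ℂ → ℝ} {E : Set ℂ} (hE : E ⊆ {z | 0 < z.im})
    (hu : AnalyticOnNhd ℝ u E) : AnalyticOnNhd ℝ (imSqDeriv u) E := by
  have e : SliceAnalysis.imSqDeriv u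
      = fun z => (-(1 / 2) : ℝ) * ((z.im)⁻¹ * fderiv ℝ u z Complex.I) := by
    funext z
    rw [SliceAnalysis.imSqDeriv, mul_inv]; ring
  rw [e]
  intro z hz
  exact analyticAt_const.mul
    ((analyticOnNhd_im_inv z (hE hz)).mul (analyticOnNhd_fderiv_apply hu _ z hz))

lemma AnalyticOnNhd.iterate_imSqDeriv {u : ℂ → ℝ} {E : Set ℂ} (hE : E ⊆ {z | 0 < z.im})
    (hu : AnalyticOnNhd ℝ u E) (k : ℕ) : AnalyticOnNhd ℝ (SliceAnalysis.imSqDeriv^[k] u) E := by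
  induction k with
  | zero => exact hu
  | succ k ih =>
    rw [Function.iterate_succ_apply']
    exact AnalyticOnNhd.imSqDeriv hE ih

lemma fderiv_fderiv_apply {u : ℂ → ℝ} {z : ℂ} (hu : AnalyticAt ℝ u z) (v h : ℂ) :
    fderiv ℝ (fun w => fderiv ℝ u w v) z h = fderiv ℝ (fderiv ℝ u) z h v := by
  have := ((ContinuousLinearMap.apply ℝ ℝ v).hasFDerivAt.comp z
    hu.fderiv.differentiableAt.hasFDerivAt).fderiv
  have h2 : fderiv ℝ (fun w => fderiv ℝ u w v) z = _ := this
  rw [h2]; rfl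

lemma fderiv_im_inv_one {z : ℂ} (hz : 0 < z.im) : fderiv ℝ (fun w : ℂ => (w.im)⁻¹) z 1 = 0 := by
  have h : HasFDerivAt (fun w : ℂ => (w.im)⁻¹) _ z :=
    (hasDerivAt_inv hz.ne').comp_hasFDerivAt z (Complex.imCLM.hasFDerivAt (x := z))
  rw [h.fderiv]
  simp

/-- The operator commutes with ∂/∂α: its coefficient depends on β only, and mixed partials agree. -/
lemma imSqDeriv_half_fderiv_one {u v : ℂ → ℝ} {E : Set ℂ} (hEo : IsOpen E)
    (hE : E ⊆ {z | 0 < z.im}) (hu : AnalyticOnNhd ℝ u E)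
    (h : ∀ z ∈ E, v z = 1 / 2 * fderiv ℝ u z 1) :
    ∀ z ∈ E, imSqDeriv v z = 1 / 2 * fderiv ℝ (imSqDeriv u) z 1 := by
  intro z hz
  have hz' : 0 < z.im := hE hz
  have hv : fderiv ℝ v z Complex.I = 1 / 2 * fderiv ℝ (fderiv ℝ u) z Complex.I 1 := by
    have e : v =ᶠ[𝓝 z] fun w => (1 / 2 : ℝ) * fderiv ℝ u w 1 :=
      Filter.eventually_of_mem (hEo.mem_nhds hz) h
    rw [e.fderiv_eq, fderiv_const_mul (analyticOnNhd_fderiv_apply hu 1 z hz).differentiableAt]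
    simp [fderiv_fderiv_apply (hu z hz)]
  have hu' : fderiv ℝ (imSqDeriv u) z 1
      = -(2 * z.im)⁻¹ * fderiv ℝ (fderiv ℝ u) z 1 Complex.I := by
    have e : imSqDeriv u = fun z => (-(1 / 2) : ℝ) * ((z.im)⁻¹ * fderiv ℝ u z Complex.I) := by
      funext z
      rw [imSqDeriv, mul_inv]; ring
    have d1 := (analyticOnNhd_im_inv z hz').differentiableAt
    have d2 := (analyticOnNhd_fderiv_apply hu Complex.I z hz).differentiableAt
    rw [e, fderiv_const_mul (d1.fun_mul d2), fderiv_fun_mul d1 d2]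
    simp [fderiv_fderiv_apply (hu z hz), fderiv_im_inv_one hz']
    ring
  have hs : fderiv ℝ (fderiv ℝ u) z Complex.I 1 = fderiv ℝ (fderiv ℝ u) z 1 Complex.I :=
    ((hu z hz).contDiffAt (n := 2)).isSymmSndFDerivAt (by simp) _ _
  rw [imSqDeriv, hv, hu', hs]
  ring

/-- `(-(2β)⁻¹ ∂/∂β)^k` of the real part of `φ`. -/
def reIter (k : ℕ) (φ : ℂ → ℂ) : ℂ → ℝ := imSqDeriv^[k] fun z => (φ z).re

/-- `(-(2β)⁻¹ ∂/∂β)^k` of `β⁻¹` times the imaginary part of `φ`. -/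
def imIter (k : ℕ) (φ : ℂ → ℂ) : ℂ → ℝ := imSqDeriv^[k] fun z => (z.im)⁻¹ * (φ z).im

/-- The part of a set that lies in the upper half plane. -/
def upperPart (D : Set ℂ) : Set ℂ := D ∩ {z | 0 < z.im}

lemma isOpen_upperPart {D : Set ℂ} (hD : IsOpen D) : IsOpen (upperPart D) :=
  hD.inter (isOpen_lt continuous_const Complex.continuous_im)

lemma analyticOnNhd_re {D : Set ℂ} (hD : IsOpen D) {φ : ℂ → ℂ} (hφ : DifferentiableOn ℂ φ D) :
    AnalyticOnNhd ℝ (fun z => (φ z).re) D := fun _ hz =>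
  (Complex.reCLM.analyticAt _).comp (hφ.analyticAt (hD.mem_nhds hz)).restrictScalars

lemma analyticOnNhd_im {D : Set ℂ} (hD : IsOpen D) {φ : ℂ → ℂ} (hφ : DifferentiableOn ℂ φ D) :
    AnalyticOnNhd ℝ (fun z => (φ z).im) D := fun _ hz =>
  (Complex.imCLM.analyticAt _).comp (hφ.analyticAt (hD.mem_nhds hz)).restrictScalars

lemma analyticOnNhd_im_inv_mul_im {D : Set ℂ} (hD : IsOpen D) {φ : ℂ → ℂ}
    (hφ : DifferentiableOn ℂ φ D) :
    AnalyticOnNhd ℝ (fun z => (z.im)⁻¹ * (φ z).im) (upperPart D) := fun z hz =>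
  (analyticOnNhd_im_inv z hz.2).mul (analyticOnNhd_im hD hφ z hz.1)

lemma analyticOnNhd_imIter {D : Set ℂ} (hD : IsOpen D) {φ : ℂ → ℂ}
    (hφ : DifferentiableOn ℂ φ D) (k : ℕ) : AnalyticOnNhd ℝ (imIter k φ) (upperPart D) :=
  AnalyticOnNhd.iterate_imSqDeriv Set.inter_subset_right (analyticOnNhd_im_inv_mul_im hD hφ) k

/-- For k = 0 this is the Cauchy–Riemann equation ∂(Im φ)/∂α = -∂(Re φ)/∂β; commutation with ∂/∂α
propagates it. It identifies the √-1-free part of ∂/∂z of the spherical derivative. -/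
lemma reIter_succ_eq_half_fderiv_imIter {D : Set ℂ} (hD : IsOpen D) {φ : ℂ → ℂ}
    (hφ : DifferentiableOn ℂ φ D) (k : ℕ) :
    ∀ z ∈ upperPart D, reIter (k + 1) φ z = 1 / 2 * fderiv ℝ (imIter k φ) z 1 := by
  induction k with
  | zero =>
    intro z hz
    have hz' : 0 < z.im := hz.2
    have hd := ((hφ.differentiableAt (hD.mem_nhds hz.1)).hasDerivAt.complexToReal_fderiv)
    have h1 : HasFDerivAt (fun w => (φ w).re) _ z := Complex.reCLM.hasFDerivAt.comp z hd
    have h2 : HasFDerivAt (fun w => (φ w).im) _ z := Complex.imCLM.hasFDerivAt.comp z hd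
    change imSqDeriv (fun w => (φ w).re) z = 1 / 2 * fderiv ℝ (fun w => (w.im)⁻¹ * (φ w).im) z 1
    rw [imSqDeriv, h1.fderiv,
      fderiv_fun_mul (analyticOnNhd_im_inv z hz').differentiableAt h2.differentiableAt, h2.fderiv]
    simp [fderiv_im_inv_one hz']
    ring
  | succ k ih =>
    have := imSqDeriv_half_fderiv_one (isOpen_upperPart hD) Set.inter_subset_right
      (analyticOnNhd_imIter hD hφ k) ih
    simpa only [reIter, imIter, Function.iterate_succ_apply'] using this

lemma iterate_imSqDeriv_vertical {u : ℂ → ℝ} {E : Set ℂ} (hEo : IsOpen E)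
    (hE : E ⊆ {z | 0 < z.im}) (hu : AnalyticOnNhd ℝ u E) (a : ℝ) (k : ℕ) :
    ∀ t : ℝ, (⟨a, t⟩ : ℂ) ∈ E →
      imSqDeriv^[k] u ⟨a, t⟩ = sqDeriv^[k] (fun s => u ⟨a, s⟩) t := by
  induction k with
  | zero => intro t _; rfl
  | succ k ih =>
    intro t ht
    have hγ : ∀ s : ℝ, HasDerivAt (fun s : ℝ => (⟨a, s⟩ : ℂ)) Complex.I s := by
      intro s
      have e : (fun s : ℝ => (⟨a, s⟩ : ℂ)) = fun s : ℝ => (a : ℂ) + (s : ℂ) * Complex.I := by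
        funext s; apply Complex.ext <;> simp
      rw [e]
      simpa using ((Complex.ofRealCLM.hasDerivAt (x := s)).mul_const Complex.I).const_add (a : ℂ)
    rw [Function.iterate_succ_apply', Function.iterate_succ_apply', imSqDeriv, sqDeriv]
    have hev : ∀ᶠ s in 𝓝 t, (⟨a, s⟩ : ℂ) ∈ E :=
      (hγ t).continuousAt.eventually_mem (hEo.mem_nhds ht)
    have e : sqDeriv^[k] (fun s => u ⟨a, s⟩) =ᶠ[𝓝 t] fun s => imSqDeriv^[k] u ⟨a, s⟩ := by
      filter_upwards [hev] with s hs using (ih s hs).symm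
    have hd := (AnalyticOnNhd.iterate_imSqDeriv hE hu k _ ht).differentiableAt.hasFDerivAt
    have := hd.comp_hasDerivAt t (hγ t)
    rw [e.deriv_eq]
    congr 1
    exact this.deriv.symm

/-- Δ is real on the vertical line through z₀, so it factors out of real and imaginary parts
separately. -/
lemma quad_vertical (z₀ : ℂ) (t : ℝ) :
    quad z₀ ⟨z₀.re, t⟩ = ((z₀.im ^ 2 - t ^ 2 : ℝ) : ℂ) := by
  apply Complex.ext
  · rw [Complex.ofReal_re]; simp [quad]; ring
  · rw [Complex.ofReal_im]; simp [quad]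

lemma analyticAt_vertical (a t : ℝ) : AnalyticAt ℝ (fun s : ℝ => (⟨a, s⟩ : ℂ)) t := by
  have e : (fun s : ℝ => (⟨a, s⟩ : ℂ)) = fun s : ℝ => (a : ℂ) + (s : ℂ) * Complex.I := by
    funext s; apply Complex.ext <;> simp
  rw [e]
  exact analyticAt_const.add ((Complex.ofRealCLM.analyticAt t).mul analyticAt_const)

lemma eventually_vertical_mem {E : Set ℂ} (hE : IsOpen E) {z₀ : ℂ} (hz₀ : z₀ ∈ E) :
    ∀ᶠ t in 𝓝 z₀.im, (⟨z₀.re, t⟩ : ℂ) ∈ E :=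
  (analyticAt_vertical z₀.re z₀.im).continuousAt.eventually_mem (hE.mem_nhds hz₀)

lemma re_vertical_eventuallyEq {D : Set ℂ} {z₀ : ℂ} {φ ψ : ℂ → ℂ} {m : ℕ} (hD : IsOpen D)
    (hz₀ : z₀ ∈ D) (h : ∀ z ∈ D, φ z = quad z₀ z ^ m * ψ z) :
    (fun t : ℝ => (φ ⟨z₀.re, t⟩).re) =ᶠ[𝓝 z₀.im]
      fun t => (z₀.im ^ 2 - t ^ 2) ^ m * (ψ ⟨z₀.re, t⟩).re := by
  filter_upwards [eventually_vertical_mem hD hz₀] with t ht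
  rw [h _ ht, quad_vertical, ← Complex.ofReal_pow, Complex.re_ofReal_mul]

lemma im_vertical_eventuallyEq {D : Set ℂ} {z₀ : ℂ} {φ ψ : ℂ → ℂ} {m : ℕ} (hD : IsOpen D)
    (hz₀ : z₀ ∈ D) (h : ∀ z ∈ D, φ z = quad z₀ z ^ m * ψ z) :
    (fun t : ℝ => t⁻¹ * (φ ⟨z₀.re, t⟩).im) =ᶠ[𝓝 z₀.im]
      fun t => (z₀.im ^ 2 - t ^ 2) ^ m * (t⁻¹ * (ψ ⟨z₀.re, t⟩).im) := by
  filter_upwards [eventually_vertical_mem hD hz₀] with t ht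
  rw [h _ ht, quad_vertical, ← Complex.ofReal_pow, Complex.im_ofReal_mul]
  ring

lemma analyticAt_re_vertical {D : Set ℂ} {z₀ : ℂ} {ψ : ℂ → ℂ} (hD : IsOpen D)
    (hz₀ : z₀ ∈ D) (hψ : DifferentiableOn ℂ ψ D) :
    AnalyticAt ℝ (fun t : ℝ => (ψ ⟨z₀.re, t⟩).re) z₀.im :=
  AnalyticAt.fun_comp (g := fun z => (ψ z).re) (analyticOnNhd_re hD hψ _ hz₀)
    (analyticAt_vertical _ _)

lemma analyticAt_im_vertical {D : Set ℂ} {z₀ : ℂ} {ψ : ℂ → ℂ} (hD : IsOpen D)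
    (hz₀ : z₀ ∈ upperPart D) (hψ : DifferentiableOn ℂ ψ D) :
    AnalyticAt ℝ (fun t : ℝ => t⁻¹ * (ψ ⟨z₀.re, t⟩).im) z₀.im :=
  AnalyticAt.fun_comp (g := fun z : ℂ => (z.im)⁻¹ * (ψ z).im)
    (analyticOnNhd_im_inv_mul_im hD hψ _ hz₀) (analyticAt_vertical _ _)

lemma reIter_eq_iterate_sqDeriv {D : Set ℂ} {z₀ : ℂ} {φ : ℂ → ℂ} (hD : IsOpen D)
    (hz₀ : z₀ ∈ upperPart D) (hφ : DifferentiableOn ℂ φ D) (k : ℕ) :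
    reIter k φ z₀ = sqDeriv^[k] (fun t => (φ ⟨z₀.re, t⟩).re) z₀.im :=
  iterate_imSqDeriv_vertical (isOpen_upperPart hD) Set.inter_subset_right
    ((analyticOnNhd_re hD hφ).mono Set.inter_subset_left) z₀.re k z₀.im hz₀

lemma imIter_eq_iterate_sqDeriv {D : Set ℂ} {z₀ : ℂ} {φ : ℂ → ℂ} (hD : IsOpen D)
    (hz₀ : z₀ ∈ upperPart D) (hφ : DifferentiableOn ℂ φ D) (k : ℕ) :
    imIter k φ z₀ = sqDeriv^[k] (fun t => t⁻¹ * (φ ⟨z₀.re, t⟩).im) z₀.im :=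
  iterate_imSqDeriv_vertical (isOpen_upperPart hD) Set.inter_subset_right
    (analyticOnNhd_im_inv_mul_im hD hφ) z₀.re k z₀.im hz₀

lemma reIter_eq_zero_and_imIter_eq_zero {D : Set ℂ} {z₀ : ℂ} {φ ψ : ℂ → ℂ} {m k : ℕ}
    (hD : IsOpen D) (hz₀ : z₀ ∈ upperPart D) (hφ : DifferentiableOn ℂ φ D)
    (hψ : DifferentiableOn ℂ ψ D) (h : ∀ z ∈ D, φ z = quad z₀ z ^ m * ψ z) (hk : k < m) :
    reIter k φ z₀ = 0 ∧ imIter k φ z₀ = 0 := by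
  have hne : z₀.im ≠ 0 := ne_of_gt hz₀.2
  rw [reIter_eq_iterate_sqDeriv hD hz₀ hφ, imIter_eq_iterate_sqDeriv hD hz₀ hφ]
  exact ⟨iterate_sqDeriv_eq_zero hne (analyticAt_re_vertical hD hz₀.1 hψ)
    (re_vertical_eventuallyEq hD hz₀.1 h) hk, iterate_sqDeriv_eq_zero hne
    (analyticAt_im_vertical hD hz₀ hψ) (im_vertical_eventuallyEq hD hz₀.1 h) hk⟩

lemma reIter_and_imIter_eq_factorial_mul {D : Set ℂ} {z₀ : ℂ} {φ ψ : ℂ → ℂ} {m : ℕ}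
    (hD : IsOpen D) (hz₀ : z₀ ∈ upperPart D) (hφ : DifferentiableOn ℂ φ D)
    (hψ : DifferentiableOn ℂ ψ D) (h : ∀ z ∈ D, φ z = quad z₀ z ^ m * ψ z) :
    reIter m φ z₀ = m.factorial * (ψ z₀).re ∧
      imIter m φ z₀ = m.factorial * ((z₀.im)⁻¹ * (ψ z₀).im) := by
  have hne : z₀.im ≠ 0 := ne_of_gt hz₀.2
  rw [reIter_eq_iterate_sqDeriv hD hz₀ hφ, imIter_eq_iterate_sqDeriv hD hz₀ hφ]
  exact ⟨iterate_sqDeriv_eq_factorial_mul hne (analyticAt_re_vertical hD hz₀.1 hψ)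
    (re_vertical_eventuallyEq hD hz₀.1 h), iterate_sqDeriv_eq_factorial_mul hne
    (analyticAt_im_vertical hD hz₀ hψ) (im_vertical_eventuallyEq hD hz₀.1 h)⟩

/-! ### The iterates of ∂_c∂_s in terms of the stem function. -/

/-- The quaternion with coordinates `T φ`, for the components `φ` of `F`. -/
def compMap (F : ℂ → ℍ[ℂ]) (T : (ℂ → ℂ) → ℝ) : ℍ[ℝ] :=
  ⟨T fun z => (F z).re, T fun z => (F z).imI, T fun z => (F z).imJ, T fun z => (F z).imK⟩

lemma sphericalDeriv_slicePoint {h : ℍ[ℝ] → ℍ[ℝ]} {z : ℂ} (hz : z.im ≠ 0) {x y : ℍ[ℝ]}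
    (hh : ∀ J ∈ imagUnits, h (slicePoint J z) = x + J * (z.im • y)) {J : ℍ[ℝ]}
    (hJ : J ∈ imagUnits) : sphericalDeriv h (slicePoint J z) = y := by
  have h0 : J ≠ 0 := by
    rintro rfl
    simpa using norm_of_mem_imagUnits hJ
  have e : x + J * (z.im • y) - (x + -J * (z.im • y)) = 2 * (z.im • J) * y := by
    simp only [two_mul, add_mul, mul_smul_comm, smul_mul_assoc, neg_mul]
    module
  rw [sphericalDeriv, star_slicePoint hJ, hh J hJ, hh _ (neg_mem_imagUnits hJ),
    im_slicePoint hJ, e, inv_mul_cancel_left₀]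
  have h2 : (2 : ℍ[ℝ]) ≠ 0 := fun h => by
    have : (1 : ℝ) + 1 = 0 := congrArg (fun q : ℍ[ℝ] => q.re) ((one_add_one_eq_two (R := ℍ[ℝ])).trans h)
    norm_num at this
  exact mul_ne_zero h2 (smul_ne_zero hz h0)

lemma wirtinger_eq {ψ : ℂ → ℂ} {u : ℂ → ℝ} {z : ℂ} (hu : DifferentiableAt ℝ u z)
    (h : ψ =ᶠ[𝓝 z] fun w => (u w : ℂ)) :
    wirtinger ψ z = ⟨1 / 2 * fderiv ℝ u z 1, -(1 / 2) * fderiv ℝ u z Complex.I⟩ := by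
  have hd : HasFDerivAt (fun w => (u w : ℂ)) _ z :=
    Complex.ofRealCLM.hasFDerivAt.comp z hu.hasFDerivAt
  rw [wirtinger, h.fderiv_eq, hd.fderiv]
  apply Complex.ext <;> simp

lemma sliceDeriv_sphericalDeriv_slicePoint {D : Set ℂ} (hD : IsOpen D) {F : ℂ → ℍ[ℂ]}
    (hF : IsHolomorphicOn F D) {h : ℍ[ℝ] → ℍ[ℝ]} {k : ℕ}
    (hh : ∀ z ∈ upperPart D, ∀ J ∈ imagUnits, h (slicePoint J z) =
      compMap F (fun φ => reIter k φ z) + J * (z.im • compMap F (fun φ => imIter k φ z)))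
    {z : ℂ} (hz : z ∈ upperPart D) {J : ℍ[ℝ]} (hJ : J ∈ imagUnits) :
    sliceDeriv (sphericalDeriv h) (slicePoint J z) =
      compMap F (fun φ => reIter (k + 1) φ z)
        + J * (z.im • compMap F (fun φ => imIter (k + 1) φ z)) := by
  obtain ⟨f1, f2, f3, f4⟩ := hF
  have hz' : z.im ≠ 0 := ne_of_gt hz.2
  have hst : ∀ᶠ w in 𝓝 z, stemOf (sphericalDeriv h) w
      = ofParts (compMap F (fun φ => imIter k φ w)) 0 := by
    filter_upwards [(isOpen_upperPart hD).mem_nhds hz] with w hw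
    refine stemOf_eq_of_slicePoint fun K hK => ?_
    rw [sphericalDeriv_slicePoint (ne_of_gt hw.2) (hh w hw) hK, mul_zero, add_zero]
  -- The stem function of the spherical derivative has real components, so ∂/∂z has parts ½∂/∂α and
  -- -½∂/∂β; the latter is β times the operator -(2β)⁻¹∂/∂β.
  have key : ∀ φ : ℂ → ℂ, DifferentiableOn ℂ φ D → ∀ ψ : ℂ → ℂ,
      (ψ =ᶠ[𝓝 z] fun w => (imIter k φ w : ℂ)) →
      wirtinger ψ z = ⟨reIter (k + 1) φ z, z.im * imIter (k + 1) φ z⟩ := by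
    intro φ hφ ψ hψ
    rw [wirtinger_eq (analyticOnNhd_imIter hD hφ k z hz).differentiableAt hψ,
      reIter_succ_eq_half_fderiv_imIter hD hφ k z hz]
    congr 1
    have e : imIter (k + 1) φ = imSqDeriv (imIter k φ) := Function.iterate_succ_apply' _ _ _
    rw [e, imSqDeriv]
    field_simp
  have e : stemDeriv (stemOf (sphericalDeriv h)) z
      = ofParts (compMap F (fun φ => reIter (k + 1) φ z))
          (z.im • compMap F (fun φ => imIter (k + 1) φ z)) := by
    apply Quaternion.ext
    · exact key _ f1 _ (hst.mono fun w hw => congrArg (fun q : ℍ[ℂ] => q.re) hw)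
    · exact key _ f2 _ (hst.mono fun w hw => congrArg (fun q : ℍ[ℂ] => q.imI) hw)
    · exact key _ f3 _ (hst.mono fun w hw => congrArg (fun q : ℍ[ℂ] => q.imJ) hw)
    · exact key _ f4 _ (hst.mono fun w hw => congrArg (fun q : ℍ[ℂ] => q.imK) hw)
  rw [sliceDeriv, induce_slicePoint hJ _ hz.2, e]
  rfl

lemma csDeriv_slicePoint {D : Set ℂ} (hD : IsOpen D) {F : ℂ → ℍ[ℂ]}
    (hF : IsHolomorphicOn F D) {f : ℍ[ℝ] → ℍ[ℝ]} (hf : IsInducedBy D F f) (k : ℕ) :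
    ∀ z ∈ upperPart D, ∀ J ∈ imagUnits, csDeriv k f (slicePoint J z) =
      compMap F (fun φ => reIter k φ z) + J * (z.im • compMap F (fun φ => imIter k φ z)) := by
  induction k with
  | zero =>
    intro z hz J hJ
    have e : z.im • compMap F (fun φ => imIter 0 φ z) = part1 (F z) := by
      have hz' : z.im ≠ 0 := ne_of_gt hz.2
      ext <;> exact mul_inv_cancel_left₀ hz' _
    rw [e]
    exact hf z hz.1 J hJ
  | succ k ih =>
    intro z hz J hJ
    rw [csDeriv, Function.iterate_succ_apply']
    exact sliceDeriv_sphericalDeriv_slicePoint hD hF ih hz hJ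

lemma sphericalDeriv_csDeriv_slicePoint {D : Set ℂ} (hD : IsOpen D) {F : ℂ → ℍ[ℂ]}
    (hF : IsHolomorphicOn F D) {f : ℍ[ℝ] → ℍ[ℝ]} (hf : IsInducedBy D F f) (k : ℕ) {z : ℂ}
    (hz : z ∈ upperPart D) {J : ℍ[ℝ]} (hJ : J ∈ imagUnits) :
    sphericalDeriv (csDeriv k f) (slicePoint J z) = compMap F (fun φ => imIter k φ z) :=
  sphericalDeriv_slicePoint (ne_of_gt hz.2) (csDeriv_slicePoint hD hF hf k z hz) hJ

lemma csDeriv_eq_zero_of_lt {D : Set ℂ} (hD : IsOpen D) {F P : ℂ → ℍ[ℂ]}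
    (hF : IsHolomorphicOn F D) (hP : IsHolomorphicOn P D) {f : ℍ[ℝ] → ℍ[ℝ]}
    (hf : IsInducedBy D F f) {z₀ : ℂ} (hz₀ : z₀ ∈ upperPart D) {m : ℕ}
    (h : ∀ z ∈ D, F z = quad z₀ z ^ m • P z) {J : ℍ[ℝ]} (hJ : J ∈ imagUnits) {k : ℕ}
    (hk : k < m) : csDeriv k f (slicePoint J z₀) = 0 ∧
      sphericalDeriv (csDeriv k f) (slicePoint J z₀) = 0 := by
  have h1 := reIter_eq_zero_and_imIter_eq_zero hD hz₀ hF.1 hP.1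
    (fun z hz => by rw [h z hz]; rfl) hk
  have h2 := reIter_eq_zero_and_imIter_eq_zero hD hz₀ hF.2.1 hP.2.1
    (fun z hz => by rw [h z hz]; rfl) hk
  have h3 := reIter_eq_zero_and_imIter_eq_zero hD hz₀ hF.2.2.1 hP.2.2.1
    (fun z hz => by rw [h z hz]; rfl) hk
  have h4 := reIter_eq_zero_and_imIter_eq_zero hD hz₀ hF.2.2.2 hP.2.2.2
    (fun z hz => by rw [h z hz]; rfl) hk
  have e0 : compMap F (fun φ => reIter k φ z₀) = 0 :=
    Quaternion.ext_iff.2 ⟨h1.1, h2.1, h3.1, h4.1⟩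
  have e1 : compMap F (fun φ => imIter k φ z₀) = 0 :=
    Quaternion.ext_iff.2 ⟨h1.2, h2.2, h3.2, h4.2⟩
  rw [sphericalDeriv_csDeriv_slicePoint hD hF hf k hz₀ hJ,
    csDeriv_slicePoint hD hF hf k z₀ hz₀ J hJ, e0, e1]
  simp

lemma csDeriv_eq_factorial_smul {D : Set ℂ} (hD : IsOpen D) {F P : ℂ → ℍ[ℂ]}
    (hF : IsHolomorphicOn F D) (hP : IsHolomorphicOn P D) {f : ℍ[ℝ] → ℍ[ℝ]}
    (hf : IsInducedBy D F f) {z₀ : ℂ} (hz₀ : z₀ ∈ upperPart D) {m : ℕ}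
    (h : ∀ z ∈ D, F z = quad z₀ z ^ m • P z) {J : ℍ[ℝ]} (hJ : J ∈ imagUnits) :
    csDeriv m f (slicePoint J z₀) = (m.factorial : ℝ) • evalAt J (P z₀) ∧
      sphericalDeriv (csDeriv m f) (slicePoint J z₀)
        = (m.factorial : ℝ) • (z₀.im)⁻¹ • part1 (P z₀) := by
  have hne : z₀.im ≠ 0 := ne_of_gt hz₀.2
  have h1 := reIter_and_imIter_eq_factorial_mul hD hz₀ hF.1 hP.1
    (fun z hz => by rw [h z hz]; rfl)
  have h2 := reIter_and_imIter_eq_factorial_mul hD hz₀ hF.2.1 hP.2.1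
    (fun z hz => by rw [h z hz]; rfl)
  have h3 := reIter_and_imIter_eq_factorial_mul hD hz₀ hF.2.2.1 hP.2.2.1
    (fun z hz => by rw [h z hz]; rfl)
  have h4 := reIter_and_imIter_eq_factorial_mul hD hz₀ hF.2.2.2 hP.2.2.2
    (fun z hz => by rw [h z hz]; rfl)
  have e0 : compMap F (fun φ => reIter m φ z₀) = (m.factorial : ℝ) • part0 (P z₀) :=
    Quaternion.ext_iff.2 ⟨h1.1, h2.1, h3.1, h4.1⟩
  have e1 : compMap F (fun φ => imIter m φ z₀)
      = (m.factorial : ℝ) • (z₀.im)⁻¹ • part1 (P z₀) :=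
    Quaternion.ext_iff.2 ⟨h1.2, h2.2, h3.2, h4.2⟩
  rw [sphericalDeriv_csDeriv_slicePoint hD hF hf m hz₀ hJ,
    csDeriv_slicePoint hD hF hf m z₀ hz₀ J hJ, e0, e1]
  refine ⟨?_, rfl⟩
  rw [smul_comm, smul_smul z₀.im, mul_inv_cancel₀ hne, one_smul, evalAt, smul_add, mul_smul_comm]

/-! ### Finite order of the norm, and comparison of factorizations. -/

lemma continuous_planePoint : Continuous planePoint := by
  have e : planePoint = fun q => (q.re : ℂ) + (‖q.im‖ : ℂ) * Complex.I := by
    funext q; apply Complex.ext <;> simp [planePoint]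
  rw [e]
  exact (Complex.continuous_ofReal.comp Quaternion.continuous_re).add
    ((Complex.continuous_ofReal.comp Quaternion.continuous_im.norm).mul continuous_const)

lemma planePoint_mem {D : Set ℂ} (hsymm : ∀ z ∈ D, star z ∈ D) {q : ℍ[ℝ]}
    (hq : q ∈ circularization D) : planePoint q ∈ D := by
  obtain ⟨z, hz, J, hJ, rfl⟩ := hq
  rcases le_total 0 z.im with h | h
  · rwa [planePoint_slicePoint hJ h]
  · have e : slicePoint J z = slicePoint (-J) (star z) := by rw [slicePoint_star, neg_neg]
    rw [e, planePoint_slicePoint (neg_mem_imagUnits hJ) (by simpa using h)]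
    exact hsymm z hz

/-- The norm vanishes on all of D by the identity theorem. At real points F takes values in ℍ, where
the norm is definite, so F = 0 on a real interval and hence on D. -/
lemma IsRegStem.eq_zero_of_normSq_eventually_eq_zero {D : Set ℂ} (hD : IsOpen D)
    (hc : IsConnected D) {t : ℝ} (ht : (t : ℂ) ∈ D) {F : ℂ → ℍ[ℂ]} (hF : IsRegStem D F) {z₀ : ℂ}
    (hz₀ : z₀ ∈ D) (h0 : ∀ᶠ z in 𝓝 z₀, Quaternion.normSq (F z) = 0) : ∀ z ∈ D, F z = 0 := by
  have hN : ∀ z ∈ D, Quaternion.normSq (F z) = 0 := fun z hz =>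
    (hF.2.normSq.analyticOnNhd hD).eqOn_zero_of_preconnected_of_eventuallyEq_zero
      hc.isPreconnected hz₀ h0 hz
  have hreal : ∀ s : ℝ, (s : ℂ) ∈ D → F s = 0 := by
    intro s hs
    have h1 := hF.1.part1_eq_zero hs (Complex.ofReal_im s)
    have h2 := hN s hs
    rw [normSq_eq_part, h1, map_zero, sub_zero, Complex.ext_iff] at h2
    exact ext_part (Quaternion.normSq_eq_zero.1 h2.1) h1
  have htend : Filter.Tendsto (fun s : ℝ => (s : ℂ)) (𝓝[≠] t) (𝓝[≠] (t : ℂ)) :=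
    Complex.continuous_ofReal.continuousAt.continuousWithinAt.tendsto_nhdsWithin
      fun s hs => by simpa using hs
  have hev : ∀ᶠ s : ℝ in 𝓝[≠] t, F s = 0 := by
    have : ∀ᶠ s : ℝ in 𝓝 t, (s : ℂ) ∈ D :=
      Complex.continuous_ofReal.continuousAt.eventually_mem (hD.mem_nhds ht)
    filter_upwards [mem_nhdsWithin_of_mem_nhds this] with s hs using hreal s hs
  have hfr : ∃ᶠ z in 𝓝[≠] (t : ℂ), F z = 0 := htend.frequently hev.frequently
  obtain ⟨-, f1, f2, f3, f4⟩ := hF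
  intro z hz
  have key : ∀ φ : ℂ → ℂ, DifferentiableOn ℂ φ D → (∃ᶠ z in 𝓝[≠] (t : ℂ), φ z = 0) → φ z = 0 :=
    fun φ hφ h => (hφ.analyticOnNhd hD).eqOn_zero_of_preconnected_of_frequently_eq_zero
      hc.isPreconnected ht h hz
  exact Quaternion.ext_iff.2 ⟨key _ f1 (hfr.mono fun w hw => congrArg (fun q : ℍ[ℂ] => q.re) hw),
    key _ f2 (hfr.mono fun w hw => congrArg (fun q : ℍ[ℂ] => q.imI) hw),
    key _ f3 (hfr.mono fun w hw => congrArg (fun q : ℍ[ℂ] => q.imJ) hw),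
    key _ f4 (hfr.mono fun w hw => congrArg (fun q : ℍ[ℂ] => q.imK) hw)⟩

lemma not_eventually_normSq_eq_zero {D : Set ℂ} (hD : IsOpen D) {F : ℂ → ℍ[ℂ]}
    {f : ℍ[ℝ] → ℍ[ℝ]} (hf : IsInducedBy D F f) {q : ℍ[ℝ]} (hq : planePoint q ∈ D)
    (h : ∃ᶠ x in 𝓝 q, ∀ y ∈ sphere x, f y ≠ 0) :
    ¬ ∀ᶠ z in 𝓝 (planePoint q), Quaternion.normSq (F z) = 0 := by
  intro h0
  have h1 := continuous_planePoint.continuousAt.eventually (h0.and (hD.mem_nhds hq))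
  obtain ⟨x, hx, hx0, hxD⟩ := (h.and_eventually h1).exists
  obtain ⟨J, hJ, hJ0⟩ := exists_evalAt_eq_zero hx0
  exact hx _ ⟨J, hJ, rfl⟩ ((hf _ hxD J hJ).trans hJ0)

/-- The order-m pair of derivatives is, up to nonzero factors, the evaluation at J and the second
part of P(z₀) ≠ 0, so it is not (0, 0), while all lower pairs are. Thus m is the first order of
nonvanishing, which is n. -/
lemma HasStemFactorization.eq_and_csDeriv_eq_zero_iff {D : Set ℂ} (hD : IsOpen D)
    {F : ℂ → ℍ[ℂ]} (hF : IsHolomorphicOn F D) {f : ℍ[ℝ] → ℍ[ℝ]} (hf : IsInducedBy D F f)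
    {z₀ : ℂ} (hz₀ : z₀ ∈ upperPart D) {J : ℍ[ℝ]} (hJ : J ∈ imagUnits) {n : ℕ}
    (hvanish : ∀ k < n, csDeriv k f (slicePoint J z₀) = 0 ∧
      sphericalDeriv (csDeriv k f) (slicePoint J z₀) = 0)
    (hne : csDeriv n f (slicePoint J z₀) ≠ 0 ∨
      sphericalDeriv (csDeriv n f) (slicePoint J z₀) ≠ 0) {m : ℕ} {qs : List ℍ[ℝ]}
    (h : HasStemFactorization D F z₀ m qs) :
    m = n ∧ (csDeriv n f (slicePoint J z₀) = 0 ↔ qs.head? = some (slicePoint J z₀)) := by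
  obtain ⟨hqs, hc, G, hG, hG0, hFG⟩ := h
  obtain ⟨hP0, hPz⟩ := linProd_mul_ne_zero_and_evalAt_eq_zero_iff hz₀.2 hG0 qs hqs hc
  have hP := (hG.linProd_mul qs).2
  have hfact : (m.factorial : ℝ) ≠ 0 := by exact_mod_cast m.factorial_ne_zero
  obtain ⟨e1, e2⟩ := csDeriv_eq_factorial_smul hD hF hP hf hz₀ hFG hJ
  have hmn : m = n := by
    rcases lt_trichotomy m n with hlt | heq | hgt
    · obtain ⟨v1, v2⟩ := hvanish m hlt
      rw [e1, smul_eq_zero_iff_right hfact] at v1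
      rw [e2, smul_eq_zero_iff_right hfact,
        smul_eq_zero_iff_right (inv_ne_zero (ne_of_gt hz₀.2))] at v2
      refine absurd (ext_part ?_ v2) hP0
      simpa [evalAt, v2] using v1
    · exact heq
    · obtain ⟨v1, v2⟩ := csDeriv_eq_zero_of_lt hD hF hP hf hz₀ hFG hJ hgt
      rcases hne with hne | hne
      · exact absurd v1 hne
      · exact absurd v2 hne
  subst hmn
  exact ⟨rfl, by rw [e1, smul_eq_zero_iff_right hfact, hPz J hJ]⟩

end SliceAnalysis

end

/-! ### The multiplicity criterion. -/

theorem corollary4p3 (D : Set ℂ) (hD : IsOpen D) (hsymm : ∀ z ∈ D, star z ∈ D)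
    (f : ℍ[ℝ] → ℍ[ℝ]) (hf : SliceAnalysis.IsSliceRegular D f)
    (q₀ : ℍ[ℝ]) (hq₀ : q₀ ∈ SliceAnalysis.circularization D) (hq₀_im : q₀.im ≠ 0)
    -- either `Ω_D` is a slice domain, or `f` does not vanish on all the spheres around `𝕊_{q₀}`
    (hnd : (IsConnected D ∧ ∃ t : ℝ, (t : ℂ) ∈ D) ∨
      ∃ᶠ x in 𝓝 q₀, ∀ y ∈ SliceAnalysis.sphere x, f y ≠ 0)
    (n : ℕ)
    (hvanish : ∀ k < n, SliceAnalysis.csDeriv k f q₀ = 0 ∧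
      SliceAnalysis.sphericalDeriv (SliceAnalysis.csDeriv k f) q₀ = 0)
    (hne : SliceAnalysis.csDeriv n f q₀ ≠ 0 ∨
      SliceAnalysis.sphericalDeriv (SliceAnalysis.csDeriv n f) q₀ ≠ 0) :
    (∀ N : ℕ, SliceAnalysis.IsSphericalMultiplicity D f q₀ N ↔ N = 2 * n) ∧
    ((∃ r : ℕ, 0 < r ∧ SliceAnalysis.IsIsolatedMultiplicity D f q₀ r) ↔
      SliceAnalysis.csDeriv n f q₀ = 0) := by
  open SliceAnalysis in
  obtain ⟨F, hs, hh, hi⟩ := hf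
  have hFD : IsRegStem D F := ⟨hs, hh⟩
  have hzD : planePoint q₀ ∈ D := planePoint_mem hsymm hq₀
  have him : 0 < (planePoint q₀).im := norm_pos_iff.2 hq₀_im
  have hz : planePoint q₀ ∈ upperPart D := ⟨hzD, him⟩
  obtain ⟨J, hJ, hqJ⟩ := exists_slicePoint hq₀_im
  have hcmp : ∀ m qs, HasFactorization D f q₀ m qs →
      m = n ∧ (csDeriv n f q₀ = 0 ↔ qs.head? = some q₀) := by
    intro m qs h
    have h' := (hasFactorization_iff hsymm hi hzD m qs).1 h
    have := h'.eq_and_csDeriv_eq_zero_iff hD hh hi hz hJ (n := n)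
    rw [← hqJ] at this
    exact this hvanish hne
  have hN : ¬ ∀ᶠ z in 𝓝 (planePoint q₀), Quaternion.normSq (F z) = 0 := by
    rcases hnd with ⟨hc, t, ht⟩ | hfr
    · intro h0
      have hF0 := hFD.eq_zero_of_normSq_eventually_eq_zero hD hc ht hzD h0
      -- When F ≡ 0, trivially F = Δ^(n+1) F, so the order-n derivatives vanish, against `hne`.
      have := csDeriv_eq_zero_of_lt hD hh hh hi hz (m := n + 1) (fun z hz => by
        rw [hF0 z hz]; apply Quaternion.ext <;> simp) hJ (Nat.lt_succ_self n)
      rw [← hqJ] at this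
      exact hne.elim (fun h => h this.1) (fun h => h this.2)
    · exact not_eventually_normSq_eq_zero hD hi hzD hfr
  obtain ⟨k, hk⟩ := ENat.ne_top_iff_exists.1 (mt analyticOrderAt_eq_top.1 hN)
  obtain ⟨m, qs, hmqs⟩ := exists_hasStemFactorization hD hsymm hzD him k F hFD hk.symm
  have hfac := (hasFactorization_iff hsymm hi hzD m qs).2 hmqs
  obtain ⟨rfl, hhead⟩ := hcmp m qs hfac
  refine ⟨fun N => ⟨?_, ?_⟩, ?_, ?_⟩
  · rintro ⟨m', qs', h', rfl⟩
    rw [(hcmp m' qs' h').1]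
  · rintro rfl
    exact ⟨m, qs, hfac, rfl⟩
  · rintro ⟨r, hr, m', qs', h', ⟨h1, -⟩ | ⟨-, h1⟩⟩
    · exact (hcmp m' qs' h').2.2 h1
    · omega
  · intro h0
    have h1 := hhead.1 h0
    refine ⟨qs.length, ?_, m, qs, hfac, Or.inl ⟨h1, rfl⟩⟩
    rw [List.length_pos_iff]
    rintro rfl
    simp at h1
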